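/- **Action theories.** Let $\mathbf O,\mathbf{AN},\mathbf{FN}$ be finite sets of object constants, action names and fluent names (names have arities), and let $\mathbf A$, $\mathbf F$ be a set of actions $a(c_1,\dots,c_m)$ and a set of fluents $f(c_1,\dots,c_m)$ over them. A fluent literal is $f$ or $\neg f$ with $f\in\mathbf F$; $f,\neg f$ are contrary. An action theory $(D,\Gamma)$ consists of a set $D$ of propositions $\mathbf{caused}(P,l)$, $\mathbf{causes}(a,l,P)$, $\mathbf{executable}(a,P)$ and a set $\Gamma$ of propositions $\mathbf{initially}(l)$, where $l$ is a fluent literal, $P$ a finite set of fluent literals and $a\in\mathbf A$. A state is a maximal consistent set $s$ of fluent literals that is closed under the static laws ($P\subseteq s\Rightarrow l\in s$ for every $\mathbf{caused}(P,l)\in D$). $Cl(u)$ is the least consistent set of fluent literals that contains $u$ and is closed under the static laws, if it exists. An action $a$ is executable in $s$ if $P\subseteq s$ for some $\mathbf{executable}(a,P)\in D$; $E(a,s)=\{l: \mathbf{causes}(a,l,P)\in D,\ P\subseteq s\}$; $\Phi(a,s)$ is the set of states $s'$ with $s'=Cl(E(a,s)\cup(s\cap s'))$ if $a$ is executable in $s$,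 and $\emptyset$ otherwise. $(D,\Gamma)$ is consistent if $\Phi(a,s)\ne\emptyset$ whenever $a\in\mathbf A$ is executable in a state $s$, and $\{l:\mathbf{initially}(l)\in\Gamma\}$ is a state, called the initial state. A trajectory is a sequence $s_0a_0s_1\dots a_{n-1}s_n$ of states $s_i$ and actions $a_i\in\mathbf A$ with $s_{i+1}\in\Phi(a_i,s_i)$ for $0\le i<n$. **Programs.** Terms are variables and constants. Formulas are built from $f(\sigma_1,\dots,\sigma_m)$ (with $f\in\mathbf{FN}$ and terms $\sigma_i$) by conjunction, disjunction, negation and quantification over nonempty finite lists of constants (an abbreviation for the finite conjunction or disjunction of the instances). Complex actions are: $a(\sigma_1,\dots,\sigma_m)$ with $a\in\mathbf{AN}$; a formula $\phi$; $\delta_1;\delta_2$; $\delta_1\mid\dots\mid\delta_k$; $\mathbf{if}\ \phi\ \mathbf{then}\ \delta_1\ \mathbf{else}\ \delta_2$; $\mathbf{while}\ \phi\ \mathbf{do}\ \delta_1$; $\mathbf{pick}(Y,\{y_1,\dots,y_m\},\delta_1)$ with constants $y_j$; procedure calls $q(\sigma_1,\dots,\sigma_m)$; and the dummy $\mathbf{null}$.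 A program $p=(S,\delta)$ consists of a set $S$ of procedures $(q(X_1,\dots,X_m):\delta_q)$, one for each procedure name, the free variables of $\delta_q$ being among the $X_i$, and a complex action $\delta$ without free variables. It is required that no body $\delta_q$ is a procedure call, that no instance $q(\bar c)$ depends on itself (the execution of a complex action depends on the actions, formulas and procedure calls in it, where all instances $\delta_1(y_j)$ count for $\mathbf{pick}$, and with a call $q(\bar c)$ on whatever $\delta_q(\bar c)$ depends on), and that the ground formulas on which the execution of $\delta$ depends use only fluents in $\mathbf F$. A trajectory $s_0a_0\dots s_n$ is a trace of $(S,\delta)$ if one of the following holds (an inductive definition): * $\delta=a$ is an action, $n=1$, $a_0=a$; or $\delta=\phi$, $n=0$, $s_0\models\phi$; or $\delta=\mathbf{null}$, $n=0$; * $\delta=\delta_1;\delta_2$, and for some $i$, $s_0\dots s_i$ is a trace of $(S,\delta_1)$ and $s_i\dots s_n$ is a trace of $(S,\delta_2)$; * $\delta=\delta_1\mid\dots\mid\delta_k$, and it is a trace of some $(S,\delta_i)$; * $\delta=\mathbf{if}\ \phi\ \mathbf{then}\ \delta_1\ \mathbf{else}\ \delta_2$, and it is a trace of $(S,\delta_1)$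 if $s_0\models\phi$, of $(S,\delta_2)$ if $s_0\not\models\phi$; * $\delta=\mathbf{while}\ \phi\ \mathbf{do}\ \delta_1$, and either $n=0$ and $s_0\not\models\phi$, or $s_0\models\phi$ and for some $i>0$, $s_0\dots s_i$ is a trace of $(S,\delta_1)$ and $s_i\dots s_n$ is a trace of $(S,\delta)$; * $\delta=\mathbf{pick}(Y,\{y_1,\dots,y_m\},\delta_1)$, and it is a trace of some $(S,\delta_1(y_j))$; * $\delta=q(\bar c)$, and it is a trace of $(S,\delta_q(\bar c))$. **The logic program.** Answer sets are stable models: $M$ is an answer set of a ground program if it is the smallest set of atoms that satisfies all rules of the Gelfond–Lifschitz reduct with respect to $M$. Fix $n\ge 0$ and a finite set $\Delta$ of fluent literals (the goal). Every ground formula and complex action $\delta$ has a name $n_\delta$: actions, fluent literals, other formulas and $\mathbf{null}$ have their own distinct names; each $q(\bar c)$ is a name of its own, which is given to the call $q(\bar c)$ and, as body of that procedure instance, to $\delta_q(\bar c)$, unless $\delta_q(\bar c)$ is an action, a formula or $\mathbf{null}$, in which case the call has the name of $\delta_q(\bar c)$; all other complex actions have their own distinct names. $\Pi^{Golog}_n$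 consists of all ground instances of the following rules, where the time variables $T,T_i,T'$ range over $\{0,\dots,n\}$. 1. Facts $action(a)$ for $a\in\mathbf A$, $fluent(f)$ for $f\in\mathbf F$, $time(t)$ for $0\le t\le n$, and $holds(l,0)$ for $\mathbf{initially}(l)\in\Gamma$. Writing $holds(P,T)$ for the list of all $holds(l',T)$ with $l'\in P$: $possible(a,T)\leftarrow time(T),holds(P,T)$ for $\mathbf{executable}(a,P)\in D$; $holds(l,T{+}1)\leftarrow time(T),occ(a,T),possible(a,T),holds(P,T)$ for $\mathbf{causes}(a,l,P)\in D$; $holds(l,T)\leftarrow time(T),holds(P,T)$ for $\mathbf{caused}(P,l)\in D$; $goal\leftarrow holds(\Delta,n)$. 2. $occ(A,T)\leftarrow action(A),time(T),possible(A,T),not\ nocc(A,T)$; $nocc(A,T)\leftarrow action(A),action(B),time(T),A\ne B,occ(B,T)$; $literal(F)\leftarrow fluent(F)$; $literal(\neg F)\leftarrow fluent(F)$; $contrary(F,\neg F)\leftarrow fluent(F)$; $contrary(\neg F,F)\leftarrow fluent(F)$; $holds(L,T{+}1)\leftarrow literal(L),literal(G),time(T),contrary(L,G),holds(L,T),not\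 holds(G,T{+}1)$; $\bot\leftarrow fluent(F),holds(F,T),holds(\neg F,T)$. 3. $formula(L)\leftarrow literal(L)$; $hf(L,T)\leftarrow literal(L),holds(L,T)$; $hf(N,T)\leftarrow formula(N),and(N,N_1,N_2),hf(N_1,T),hf(N_2,T)$; $hf(N,T)\leftarrow formula(N),or(N,N_1,N_2),hf(N_i,T)$ for $i=1,2$; $hf(N,T)\leftarrow formula(N),negation(N,N_1),not\ hf(N_1,T)$; $hf(N,T)\leftarrow formula(N),until(N,N_1,N_2),T\le T',hf\_during(N_1,T,T'),hf(N_2,T')$; $hf(N,T)\leftarrow formula(N),always(N,N_1),hf\_during(N_1,T,n)$; $hf(N,T)\leftarrow formula(N),eventually(N,N_1),hf(N_1,T'),T\le T'$; $hf(N,T)\leftarrow formula(N),next(N,N_1),hf(N_1,T{+}1)$; $hf\_during(N,T,T)\leftarrow hf(N,T)$; $hf\_during(N,T,T')\leftarrow hf(N,T),T<T',hf\_during(N,T{+}1,T')$. 4. $trans(A,T,T{+}1)\leftarrow action(A),occ(A,T)$; $trans(F,T,T)\leftarrow formula(F),hf(F,T)$; $trans(N,T_1,T_2)\leftarrow sequence(N,N_1,N_2),T_1\le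 T'\le T_2,trans(N_1,T_1,T'),trans(N_2,T',T_2)$; and, for $T_1\le T_2$: $trans(N,T_1,T_2)\leftarrow choiceAction(N),in(N_1,N),trans(N_1,T_1,T_2)$; $trans(N,T_1,T_2)\leftarrow if(N,F,N_1,N_2),hf(F,T_1),trans(N_1,T_1,T_2)$; $trans(N,T_1,T_2)\leftarrow if(N,F,N_1,N_2),not\ hf(F,T_1),trans(N_2,T_1,T_2)$; $trans(N,T_1,T_2)\leftarrow while(N,F,N_1),hf(F,T_1),T_1<T'\le T_2,trans(N_1,T_1,T'),trans(N,T',T_2)$; $trans(N,T,T)\leftarrow while(N,F,N_1),not\ hf(F,T)$; $trans(N,T_1,T_2)\leftarrow choiceArgs(N,N_1),trans(N_1,T_1,T_2)$; $trans(\mathbf{null},T,T)\leftarrow$. 5. The facts $r(p)$: for $\delta$, for all ground instances $\delta_q(\bar c)$ of the procedure bodies, and for all their components: $sequence(n_{\delta_1;\delta_2},n_{\delta_1},n_{\delta_2})$; $choiceAction(n_{\delta'})$ and $in(n_{\delta_i},n_{\delta'})$ for $\delta'=\delta_1\mid\dots\mid\delta_k$; $if(n_{\delta'},n_\phi,n_{\delta_1},n_{\delta_2})$;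 $while(n_{\delta'},n_\phi,n_{\delta_1})$; $choiceArgs(n_{\delta'},n_{\delta_1(y_j)})$ for $\mathbf{pick}$; and for each occurring subformula $\phi$ that is not a fluent literal, $formula(n_\phi)$ together with $and(n_\phi,n_{\phi_1},n_{\phi_2})$, $or(n_\phi,n_{\phi_1},n_{\phi_2})$ or $negation(n_\phi,n_{\phi_1})$. 6. The constraint $\bot\leftarrow not\ trans(n_p,0,n)$, where $n_p=n_\delta$. For a set $M$ of atoms let $s_i(M)$ be the set of fluent literals $l$ with $holds(l,i)\in M$. **Theorem.** Let $(D,\Gamma)$ be a consistent action theory, $p=(S,\delta)$ a program, $n\ge0$, and $\Delta$ a finite set of fluent literals. Then (i) for every answer set $M$ of $\Pi^{Golog}_n$ with $occ(a_i,i)\in M$ for $i\in\{0,\dots,n-1\}$, the sequence $s_0(M)a_0\dots a_{n-1}s_n(M)$ is a trace of $p$ (in particular a trajectory); and (ii) if $s_0a_0\dots a_{n-1}s_n$ is a trace of $p$ and $s_0=\{l:\mathbf{initially}(l)\in\Gamma\}$ is the initial state, then there is an answer set $M$ of $\Pi^{Golog}_n$ such that $s_j=s_j(M)$ for $j\in\{0,\dots,n\}$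 and $occ(a_i,i)\in M$ for $i\in\{0,\dots,n-1\}$. -/

import Mathlib

namespace GologPlanning

universe u v

/-! ### Signatures, fluent literals, action theories of the language B -/

/-- A signature: finitely many object constants, action names and fluent names, with arities. -/
structure Signature where
  Obj : Type u
  ActName : Type u
  FluName : Type u
  actArity : ActName → ℕ
  fluArity : FluName → ℕ
  finite_obj : Finite Obj
  finite_act : Finite ActName
  finite_flu : Finite FluName

/-- Expressions `a(c₁,…,cₙ)` with `a` an action name. -/
structure GAction (σ : Signature.{u}) where
  name : σ.ActName
  args : Fin (σ.actArity name) → σ.Obj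

/-- Expressions `f(c₁,…,cₙ)` with `f` a fluent name. -/
structure GFluent (σ : Signature.{u}) where
  name : σ.FluName
  args : Fin (σ.fluArity name) → σ.Obj

/-- Fluent literals `f` and `¬ f`. -/
inductive Lit (σ : Signature.{u}) where
  | pos (f : GFluent σ)
  | neg (f : GFluent σ)

/-- The fluent of a literal. -/
def Lit.fluent {σ : Signature.{u}} : Lit σ → GFluent σ
  | .pos f => f
  | .neg f => f

/-- `caused(pre, eff)` -/
structure StaticLaw (σ : Signature.{u}) where
  pre : Finset (Lit σ)
  eff : Lit σ

/-- `causes(act, eff, pre)` -/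
structure DynamicLaw (σ : Signature.{u}) where
  act : GAction σ
  eff : Lit σ
  pre : Finset (Lit σ)

/-- `executable(act, pre)` -/
structure ExecLaw (σ : Signature.{u}) where
  act : GAction σ
  pre : Finset (Lit σ)

/-- An action theory `(D, Γ)`: the set of actions, the set of fluents, the three kinds of
propositions of the domain description `D`, and the set `initial` of the literals `l` for which
`initially(l)` belongs to `Γ`. All propositions speak about the given actions and fluents. -/
structure ActionTheory (σ : Signature.{u}) where
  actions : Set (GAction σ)
  fluents : Set (GFluent σ)
  static : Set (StaticLaw σ)
  dynamic : Set (DynamicLaw σ)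
  exec : Set (ExecLaw σ)
  initial : Set (Lit σ)
  static_wf : ∀ r ∈ static, r.eff.fluent ∈ fluents ∧ ∀ l ∈ r.pre, l.fluent ∈ fluents
  dynamic_wf : ∀ r ∈ dynamic,
    r.act ∈ actions ∧ r.eff.fluent ∈ fluents ∧ ∀ l ∈ r.pre, l.fluent ∈ fluents
  exec_wf : ∀ r ∈ exec, r.act ∈ actions ∧ ∀ l ∈ r.pre, l.fluent ∈ fluents
  initial_wf : ∀ l ∈ initial, l.fluent ∈ fluents

namespace ActionTheory

variable {σ : Signature.{u}} (T : ActionTheory σ)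

/-- The fluent literals over the fluents of the theory. -/
def literals : Set (Lit σ) := {l | l.fluent ∈ T.fluents}

end ActionTheory

/-- No fluent occurs both positively and negatively. -/
def ConsistentLits {σ : Signature.{u}} (u : Set (Lit σ)) : Prop :=
  ∀ f, ¬ (Lit.pos f ∈ u ∧ Lit.neg f ∈ u)

/-- `u` is closed under the set `K` of static causal laws. -/
def ClosedUnder {σ : Signature.{u}} (K : Set (StaticLaw σ)) (u : Set (Lit σ)) : Prop :=
  ∀ r ∈ K, (∀ l ∈ r.pre, l ∈ u) → r.eff ∈ u

namespace ActionTheory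

variable {σ : Signature.{u}} (T : ActionTheory σ)

/-- Interpretations: maximal consistent sets of literals of the theory. -/
def IsInterpretation (s : Set (Lit σ)) : Prop :=
  Maximal (fun w => w ⊆ T.literals ∧ ConsistentLits w) s

/-- States: interpretations closed under the static causal laws. -/
def IsState (s : Set (Lit σ)) : Prop :=
  T.IsInterpretation s ∧ ClosedUnder T.static s

/-- `Cl(u)` is defined and equal to `v`: `v` is the least consistent set of literals that
contains `u` and is closed under the static causal laws. -/
def IsClosure (u v : Set (Lit σ)) : Prop :=
  IsLeast {w | w ⊆ T.literals ∧ ConsistentLits w ∧ u ⊆ w ∧ ClosedUnder T.static w} v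

/-- The action `a` is executable in `s`. -/
def Executable (a : GAction σ) (s : Set (Lit σ)) : Prop :=
  ∃ r ∈ T.exec, r.act = a ∧ ∀ l ∈ r.pre, l ∈ s

/-- The direct effects `E(a, s)`. -/
def directEffects (a : GAction σ) (s : Set (Lit σ)) : Set (Lit σ) :=
  {f | ∃ r ∈ T.dynamic, r.act = a ∧ r.eff = f ∧ ∀ l ∈ r.pre, l ∈ s}

/-- The transition function `Φ(a, s)`. -/
def transition (a : GAction σ) (s : Set (Lit σ)) : Set (Set (Lit σ)) :=
  {s' | T.Executable a s ∧ T.IsState s' ∧ T.IsClosure (T.directEffects a s ∪ (s ∩ s')) s'}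

/-- Consistent action theories. -/
def IsConsistent : Prop :=
  (∀ a ∈ T.actions, ∀ s, T.IsState s → T.Executable a s → (T.transition a s).Nonempty) ∧
    T.IsState T.initial

/-- `s 0, a 0, s 1, …, a (n-1), s n` is a trajectory (later values of `s`, `a` are irrelevant). -/
def IsTrajectory (n : ℕ) (s : ℕ → Set (Lit σ)) (a : ℕ → GAction σ) : Prop :=
  (∀ i ≤ n, T.IsState (s i)) ∧
    ∀ i < n, a i ∈ T.actions ∧ s (i + 1) ∈ T.transition (a i) (s i)

end ActionTheory

/-! ### Formulas, complex actions, programs -/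

/-- Terms over the variables `X₀, …, X_{k-1}`. -/
inductive Term (σ : Signature.{u}) (k : ℕ) where
  | var (i : Fin k)
  | const (c : σ.Obj)

/-- The value of a term under a substitution of constants for the variables. -/
def Term.ground {σ : Signature.{u}} {k : ℕ} (c : Fin k → σ.Obj) : Term σ k → σ.Obj
  | .var i => c i
  | .const d => d

/-- Formulas with free variables among `X₀, …, X_{k-1}`. The quantifiers bind the variable `X_k`,
which ranges over the nonempty list `c :: cs` of constants. -/
inductive Formula (σ : Signature.{u}) : ℕ → Type u where
  | atom {k : ℕ} (f : σ.FluName) (ts : Fin (σ.fluArity f) → Term σ k) : Formula σ k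
  | and {k : ℕ} (φ ψ : Formula σ k) : Formula σ k
  | or {k : ℕ} (φ ψ : Formula σ k) : Formula σ k
  | neg {k : ℕ} (φ : Formula σ k) : Formula σ k
  | ex {k : ℕ} (c : σ.Obj) (cs : List σ.Obj) (φ : Formula σ (k + 1)) : Formula σ k
  | all {k : ℕ} (c : σ.Obj) (cs : List σ.Obj) (φ : Formula σ (k + 1)) : Formula σ k

/-- Ground quantifier-free formulas. -/
inductive GFormula (σ : Signature.{u}) where
  | atom (f : GFluent σ)
  | and (φ ψ : GFormula σ)
  | or (φ ψ : GFormula σ)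
  | neg (φ : GFormula σ)

namespace GFormula

variable {σ : Signature.{u}}

/-- `or(φ, or(φ₁, …))` -/
def bigOr : GFormula σ → List (GFormula σ) → GFormula σ
  | φ, [] => φ
  | φ, ψ :: l => .or φ (bigOr ψ l)

/-- `and(φ, and(φ₁, …))` -/
def bigAnd : GFormula σ → List (GFormula σ) → GFormula σ
  | φ, [] => φ
  | φ, ψ :: l => .and φ (bigAnd ψ l)

/-- A fluent literal as a formula. -/
def ofLit : Lit σ → GFormula σ
  | .pos f => .atom f
  | .neg f => .neg (.atom f)

/-- Truth of a formula in a set of literals (meant for interpretations). -/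
def Holds (s : Set (Lit σ)) : GFormula σ → Prop
  | .atom f => Lit.pos f ∈ s
  | .and φ ψ => φ.Holds s ∧ ψ.Holds s
  | .or φ ψ => φ.Holds s ∨ ψ.Holds s
  | .neg φ => ¬ φ.Holds s

/-- The fluents occurring in a formula. -/
def fluents : GFormula σ → Set (GFluent σ)
  | .atom f => {f}
  | .and φ ψ => φ.fluents ∪ ψ.fluents
  | .or φ ψ => φ.fluents ∪ ψ.fluents
  | .neg φ => φ.fluents

end GFormula

/-- The ground instance `φ(c)`, with quantifiers expanded into conjunctions and disjunctions. -/
def Formula.ground {σ : Signature.{u}} : {k : ℕ} → Formula σ k → (Fin k → σ.Obj) → GFormula σ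
  | _, .atom f ts, c => .atom ⟨f, fun i => (ts i).ground c⟩
  | _, .and φ ψ, c => .and (φ.ground c) (ψ.ground c)
  | _, .or φ ψ, c => .or (φ.ground c) (ψ.ground c)
  | _, .neg φ, c => .neg (φ.ground c)
  | _, .ex d ds φ, c =>
      GFormula.bigOr (φ.ground (Fin.snoc (α := fun _ => σ.Obj) c d))
        (ds.map fun e => φ.ground (Fin.snoc (α := fun _ => σ.Obj) c e))
  | _, .all d ds φ, c =>
      GFormula.bigAnd (φ.ground (Fin.snoc (α := fun _ => σ.Obj) c d))
        (ds.map fun e => φ.ground (Fin.snoc (α := fun _ => σ.Obj) c e))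

/-- Procedure names with their numbers of variables. -/
structure ProcNames where
  Name : Type v
  arity : Name → ℕ

/-- Complex actions with free variables among `X₀, …, X_{k-1}`. In `pick cs δ` the variable `X_k` of
`δ` is to be chosen from the set `cs`. `null` is the dummy program that performs no action (for
conditionals without an else-part). -/
inductive CAction (σ : Signature.{u}) (π : ProcNames.{v}) : ℕ → Type (max u v) where
  | act {k : ℕ} (a : σ.ActName) (ts : Fin (σ.actArity a) → Term σ k) : CAction σ π k
  | test {k : ℕ} (φ : Formula σ k) : CAction σ π k
  | seq {k : ℕ} (δ₁ δ₂ : CAction σ π k) : CAction σ π k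
  | choice {k : ℕ} (m : ℕ) (δ : Fin m → CAction σ π k) : CAction σ π k
  | ite {k : ℕ} (φ : Formula σ k) (δ₁ δ₂ : CAction σ π k) : CAction σ π k
  | loop {k : ℕ} (φ : Formula σ k) (δ : CAction σ π k) : CAction σ π k
  | pick {k : ℕ} (cs : Finset σ.Obj) (δ : CAction σ π (k + 1)) : CAction σ π k
  | call {k : ℕ} (p : π.Name) (ts : Fin (π.arity p) → Term σ k) : CAction σ π k
  | null {k : ℕ} : CAction σ π k

/-- Ground complex actions. In `pick cs δ`, `δ y` is the instance for the constant `y`. -/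
inductive GCAction (σ : Signature.{u}) (π : ProcNames.{v}) : Type (max u v) where
  | act (a : GAction σ)
  | test (φ : GFormula σ)
  | seq (δ₁ δ₂ : GCAction σ π)
  | choice (m : ℕ) (δ : Fin m → GCAction σ π)
  | ite (φ : GFormula σ) (δ₁ δ₂ : GCAction σ π)
  | loop (φ : GFormula σ) (δ : GCAction σ π)
  | pick (cs : Finset σ.Obj) (δ : σ.Obj → GCAction σ π)
  | call (p : π.Name) (c : Fin (π.arity p) → σ.Obj)
  | null

/-- The ground instance `δ(c)`. -/
def CAction.ground {σ : Signature.{u}} {π : ProcNames.{v}} :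
    {k : ℕ} → CAction σ π k → (Fin k → σ.Obj) → GCAction σ π
  | _, .act a ts, c => .act ⟨a, fun i => (ts i).ground c⟩
  | _, .test φ, c => .test (φ.ground c)
  | _, .seq δ₁ δ₂, c => .seq (δ₁.ground c) (δ₂.ground c)
  | _, .choice m δ, c => .choice m fun i => (δ i).ground c
  | _, .ite φ δ₁ δ₂, c => .ite (φ.ground c) (δ₁.ground c) (δ₂.ground c)
  | _, .loop φ δ, c => .loop (φ.ground c) (δ.ground c)
  | _, .pick cs δ, c => .pick cs fun y => δ.ground (Fin.snoc (α := fun _ => σ.Obj) c y)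
  | _, .call p ts, c => .call p fun i => (ts i).ground c
  | _, .null, _ => .null

/-- A set of procedures: each procedure name has exactly one body. -/
abbrev Procedures (σ : Signature.{u}) (π : ProcNames.{v}) :=
  (p : π.Name) → CAction σ π (π.arity p)

/-- `Prim S δ x`: the action, test or procedure call `x` belongs to `prim(δ)`, the set of those on
which the execution of the ground complex action `δ` might depend. -/
inductive Prim {σ : Signature.{u}} {π : ProcNames.{v}} (S : Procedures σ π) :
    GCAction σ π → GCAction σ π → Prop
  | act (a : GAction σ) : Prim S (.act a) (.act a)
  | test (φ : GFormula σ) : Prim S (.test φ) (.test φ)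
  | seq_left {δ₁ δ₂ x : GCAction σ π} : Prim S δ₁ x → Prim S (.seq δ₁ δ₂) x
  | seq_right {δ₁ δ₂ x : GCAction σ π} : Prim S δ₂ x → Prim S (.seq δ₁ δ₂) x
  | choice {m : ℕ} {δ : Fin m → GCAction σ π} {x : GCAction σ π} (i : Fin m) :
      Prim S (δ i) x → Prim S (.choice m δ) x
  | ite_cond (φ : GFormula σ) (δ₁ δ₂ : GCAction σ π) : Prim S (.ite φ δ₁ δ₂) (.test φ)
  | ite_then {φ : GFormula σ} {δ₁ δ₂ x : GCAction σ π} : Prim S δ₁ x → Prim S (.ite φ δ₁ δ₂) x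
  | ite_else {φ : GFormula σ} {δ₁ δ₂ x : GCAction σ π} : Prim S δ₂ x → Prim S (.ite φ δ₁ δ₂) x
  | loop_cond (φ : GFormula σ) (δ : GCAction σ π) : Prim S (.loop φ δ) (.test φ)
  | loop_body {φ : GFormula σ} {δ x : GCAction σ π} : Prim S δ x → Prim S (.loop φ δ) x
  | pick {cs : Finset σ.Obj} {δ : σ.Obj → GCAction σ π} {x : GCAction σ π} (y : σ.Obj) :
      y ∈ cs → Prim S (δ y) x → Prim S (.pick cs δ) x
  | call_self (p : π.Name) (c : Fin (π.arity p) → σ.Obj) : Prim S (.call p c) (.call p c)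
  | call_body {p : π.Name} {c : Fin (π.arity p) → σ.Obj} {x : GCAction σ π} :
      Prim S ((S p).ground c) x → Prim S (.call p c) x

/-- Every procedure is well-defined (no instance depends on itself) and not nested (its body is not
a procedure call). -/
def Coherent {σ : Signature.{u}} {π : ProcNames.{v}} (S : Procedures σ π) : Prop :=
  (∀ (p : π.Name) (c : Fin (π.arity p) → σ.Obj), ¬ Prim S ((S p).ground c) (.call p c)) ∧
    ∀ (p q : π.Name) (ts : Fin (π.arity q) → Term σ (π.arity p)), S p ≠ .call q ts

/-- A program `(S, δ)`: a coherent set of procedures and a complex action without free variables. -/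
structure Program (σ : Signature.{u}) (π : ProcNames.{v}) where
  procs : Procedures σ π
  main : CAction σ π 0
  coherent : Coherent procs

namespace Program

variable {σ : Signature.{u}} {π : ProcNames.{v}} (P : Program σ π)

/-- The complex action of the program, as a ground complex action. -/
def body : GCAction σ π := P.main.ground Fin.elim0

/-- The formulas on which the execution of the program might depend are built from fluents of the
action theory. -/
def IsOver (T : ActionTheory σ) : Prop :=
  ∀ φ : GFormula σ, Prim P.procs P.body (.test φ) → φ.fluents ⊆ T.fluents

end Program

/-- `TraceOf S s a δ i j`: the sequence `s i, a i, …, a (j-1), s j` unfolds the ground complex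
action `δ`. -/
inductive TraceOf {σ : Signature.{u}} {π : ProcNames.{v}} (S : Procedures σ π)
    (s : ℕ → Set (Lit σ)) (a : ℕ → GAction σ) : GCAction σ π → ℕ → ℕ → Prop
  | act (i : ℕ) : TraceOf S s a (.act (a i)) i (i + 1)
  | test {φ : GFormula σ} (i : ℕ) : φ.Holds (s i) → TraceOf S s a (.test φ) i i
  | seq {δ₁ δ₂ : GCAction σ π} {i k j : ℕ} : i ≤ k → k ≤ j →
      TraceOf S s a δ₁ i k → TraceOf S s a δ₂ k j → TraceOf S s a (.seq δ₁ δ₂) i j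
  | choice {m : ℕ} {δ : Fin m → GCAction σ π} {i j : ℕ} (l : Fin m) :
      TraceOf S s a (δ l) i j → TraceOf S s a (.choice m δ) i j
  | ite_true {φ : GFormula σ} {δ₁ δ₂ : GCAction σ π} {i j : ℕ} :
      φ.Holds (s i) → TraceOf S s a δ₁ i j → TraceOf S s a (.ite φ δ₁ δ₂) i j
  | ite_false {φ : GFormula σ} {δ₁ δ₂ : GCAction σ π} {i j : ℕ} :
      ¬ φ.Holds (s i) → TraceOf S s a δ₂ i j → TraceOf S s a (.ite φ δ₁ δ₂) i j
  | loop_false {φ : GFormula σ} {δ : GCAction σ π} (i : ℕ) :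
      ¬ φ.Holds (s i) → TraceOf S s a (.loop φ δ) i i
  | loop_true {φ : GFormula σ} {δ : GCAction σ π} {i k j : ℕ} : φ.Holds (s i) → i < k → k ≤ j →
      TraceOf S s a δ i k → TraceOf S s a (.loop φ δ) k j → TraceOf S s a (.loop φ δ) i j
  | pick {cs : Finset σ.Obj} {δ : σ.Obj → GCAction σ π} {i j : ℕ} (y : σ.Obj) : y ∈ cs →
      TraceOf S s a (δ y) i j → TraceOf S s a (.pick cs δ) i j
  | call {p : π.Name} {c : Fin (π.arity p) → σ.Obj} {i j : ℕ} :
      TraceOf S s a ((S p).ground c) i j → TraceOf S s a (.call p c) i j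
  | null (i : ℕ) : TraceOf S s a .null i i

/-- `s 0, a 0, s 1, …, a (n-1), s n` is a trajectory of the theory and a trace of the program. -/
def IsTrace {σ : Signature.{u}} {π : ProcNames.{v}} (T : ActionTheory σ) (P : Program σ π) (n : ℕ)
    (s : ℕ → Set (Lit σ)) (a : ℕ → GAction σ) : Prop :=
  T.IsTrajectory n s a ∧ TraceOf P.procs s a P.body 0 n

/-! ### Ground logic programs and answer sets -/

/-- A ground rule; the head `none` stands for `⊥`, `pos` are the atoms of the body and `neg` the
atoms under negation as failure. -/
structure Rule (α : Type*) where
  head : Option α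
  pos : Set α
  neg : Set α

/-- `X` satisfies the rule `r`. -/
def Rule.SatisfiedBy {α : Type*} (r : Rule α) (X : Set α) : Prop :=
  r.pos ⊆ X → Disjoint r.neg X → ∃ h, r.head = some h ∧ h ∈ X

/-- The reduct of a ground program with respect to `X`. -/
def reduct {α : Type*} (Q : Set (Rule α)) (X : Set α) : Set (Rule α) :=
  {r' | ∃ r ∈ Q, Disjoint r.neg X ∧ r' = ⟨r.head, r.pos, ∅⟩}

/-- `X` is an answer set: it is the smallest set of atoms satisfying all rules of the reduct. -/
def IsAnswerSet {α : Type*} (Q : Set (Rule α)) (X : Set α) : Prop :=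
  IsLeast {Y | ∀ r ∈ reduct Q X, r.SatisfiedBy Y} X

/-! ### The logic program -/

/-- Names of formulas and complex actions: the ground terms themselves. -/
abbrev Label (σ : Signature.{u}) (π : ProcNames.{v}) := GCAction σ π

/-- The ground atoms. -/
inductive Atom (σ : Signature.{u}) (π : ProcNames.{v}) where
  | action (a : GAction σ)
  | fluent (f : GFluent σ)
  | time (t : ℕ)
  | holds (l : Lit σ) (t : ℕ)
  | possible (a : GAction σ) (t : ℕ)
  | occ (a : GAction σ) (t : ℕ)
  | nocc (a : GAction σ) (t : ℕ)
  | literal (l : Lit σ)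
  | contrary (l g : Lit σ)
  | goal
  | formula (N : Label σ π)
  | conj (N N₁ N₂ : Label σ π)
  | disj (N N₁ N₂ : Label σ π)
  | negation (N N₁ : Label σ π)
  | until (N N₁ N₂ : Label σ π)
  | always (N N₁ : Label σ π)
  | eventually (N N₁ : Label σ π)
  | next (N N₁ : Label σ π)
  | hf (N : Label σ π) (t : ℕ)
  | hfDuring (N : Label σ π) (t t' : ℕ)
  | sequence (N N₁ N₂ : Label σ π)
  | choiceAction (N : Label σ π)
  | inChoice (N₁ N : Label σ π)
  | ifThenElse (N F N₁ N₂ : Label σ π)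
  | whileDo (N F N₁ : Label σ π)
  | choiceArgs (N N₁ : Label σ π)
  | trans (N : Label σ π) (t₁ t₂ : ℕ)

/-- The name of a fluent literal. -/
def litLabel {σ : Signature.{u}} {π : ProcNames.{v}} (l : Lit σ) : Label σ π :=
  .test (GFormula.ofLit l)

/-- The facts `r(φ)`; fluent literals need none. -/
def GFormula.facts {σ : Signature.{u}} (π : ProcNames.{v}) : GFormula σ → Set (Atom σ π)
  | .atom _ => ∅
  | .and φ ψ => φ.facts π ∪ ψ.facts π ∪
      {.formula (.test (.and φ ψ)), .conj (.test (.and φ ψ)) (.test φ) (.test ψ)}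
  | .or φ ψ => φ.facts π ∪ ψ.facts π ∪
      {.formula (.test (.or φ ψ)), .disj (.test (.or φ ψ)) (.test φ) (.test ψ)}
  | .neg φ => φ.facts π ∪
      match φ with
      | .atom _ => ∅
      | _ => {.formula (.test (.neg φ)), .negation (.test (.neg φ)) (.test φ)}

/-- The name `n_δ` of a ground complex action. A procedure call names the body of the procedure
instance; but actions, formulas and `null` always keep their own names, also as such bodies. -/
def label {σ : Signature.{u}} {π : ProcNames.{v}} (S : Procedures σ π) :
    GCAction σ π → Label σ π
  | .call p c =>
      match (S p).ground c with
      | .act a => .act a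
      | .test φ => .test φ
      | .null => .null
      | _ => .call p c
  | δ => δ

/-- The facts `r(δ)` encoding the ground complex action `δ` under the name `N`; its components
are encoded under their names given by `label`. -/
def encode {σ : Signature.{u}} {π : ProcNames.{v}} (S : Procedures σ π) :
    Label σ π → GCAction σ π → Set (Atom σ π)
  | _, .act _ => ∅
  | _, .test φ => φ.facts π
  | N, .seq δ₁ δ₂ => {.sequence N (label S δ₁) (label S δ₂)} ∪
      encode S (label S δ₁) δ₁ ∪ encode S (label S δ₂) δ₂
  | N, .choice _ δ => {.choiceAction N} ∪ {x | ∃ i, x = .inChoice (label S (δ i)) N} ∪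
      ⋃ i, encode S (label S (δ i)) (δ i)
  | N, .ite φ δ₁ δ₂ => {.ifThenElse N (.test φ) (label S δ₁) (label S δ₂)} ∪ φ.facts π ∪
      encode S (label S δ₁) δ₁ ∪ encode S (label S δ₂) δ₂
  | N, .loop φ δ => {.whileDo N (.test φ) (label S δ)} ∪ φ.facts π ∪ encode S (label S δ) δ
  | N, .pick cs δ => {x | ∃ y ∈ cs, x = .choiceArgs N (label S (δ y))} ∪
      ⋃ y ∈ cs, encode S (label S (δ y)) (δ y)
  | _, .call _ _ => ∅
  | _, .null => ∅

/-- The facts `r(p)` encoding a program: those of its complex action and those of all ground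
instances of its procedures. -/
def Program.facts {σ : Signature.{u}} {π : ProcNames.{v}} (P : Program σ π) : Set (Atom σ π) :=
  encode P.procs (label P.procs P.body) P.body ∪
    ⋃ (p : π.Name) (c : Fin (π.arity p) → σ.Obj),
      encode P.procs (label P.procs (.call p c)) ((P.procs p).ground c)

section Rules

variable {σ : Signature.{u}} (π : ProcNames.{v})

/-- The ground rules of `Π_n` without the goal constraint. Times range over `0, …, n`. -/
inductive PlanningRule (T : ActionTheory σ) (Δ : Finset (Lit σ)) (n : ℕ) : Rule (Atom σ π) → Prop
  | action (a : GAction σ) : a ∈ T.actions → PlanningRule T Δ n ⟨some (.action a), ∅, ∅⟩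
  | fluent (f : GFluent σ) : f ∈ T.fluents → PlanningRule T Δ n ⟨some (.fluent f), ∅, ∅⟩
  | time (t : ℕ) : t ≤ n → PlanningRule T Δ n ⟨some (.time t), ∅, ∅⟩
  | initially (l : Lit σ) : l ∈ T.initial → PlanningRule T Δ n ⟨some (.holds l 0), ∅, ∅⟩
  | executable (r : ExecLaw σ) (t : ℕ) : r ∈ T.exec → t ≤ n →
      PlanningRule T Δ n
        ⟨some (.possible r.act t), {.time t} ∪ {x | ∃ l ∈ r.pre, x = .holds l t}, ∅⟩
  | causes (r : DynamicLaw σ) (t : ℕ) : r ∈ T.dynamic → t ≤ n →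
      PlanningRule T Δ n
        ⟨some (.holds r.eff (t + 1)),
          {.time t, .occ r.act t, .possible r.act t} ∪ {x | ∃ l ∈ r.pre, x = .holds l t}, ∅⟩
  | caused (r : StaticLaw σ) (t : ℕ) : r ∈ T.static → t ≤ n →
      PlanningRule T Δ n
        ⟨some (.holds r.eff t), {.time t} ∪ {x | ∃ l ∈ r.pre, x = .holds l t}, ∅⟩
  | occ (a : GAction σ) (t : ℕ) : t ≤ n →
      PlanningRule T Δ n
        ⟨some (.occ a t), {.action a, .time t, .possible a t}, {.nocc a t}⟩
  | nocc (a b : GAction σ) (t : ℕ) : a ≠ b → t ≤ n →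
      PlanningRule T Δ n
        ⟨some (.nocc a t), {.action a, .action b, .time t, .occ b t}, ∅⟩
  | literal_pos (f : GFluent σ) : PlanningRule T Δ n ⟨some (.literal (.pos f)), {.fluent f}, ∅⟩
  | literal_neg (f : GFluent σ) : PlanningRule T Δ n ⟨some (.literal (.neg f)), {.fluent f}, ∅⟩
  | contrary_pos (f : GFluent σ) :
      PlanningRule T Δ n ⟨some (.contrary (.pos f) (.neg f)), {.fluent f}, ∅⟩
  | contrary_neg (f : GFluent σ) :
      PlanningRule T Δ n ⟨some (.contrary (.neg f) (.pos f)), {.fluent f}, ∅⟩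
  | inertia (l g : Lit σ) (t : ℕ) : t ≤ n →
      PlanningRule T Δ n
        ⟨some (.holds l (t + 1)),
          {.literal l, .literal g, .time t, .contrary l g, .holds l t}, {.holds g (t + 1)}⟩
  | consistency (f : GFluent σ) (t : ℕ) : t ≤ n →
      PlanningRule T Δ n ⟨none, {.fluent f, .holds (.pos f) t, .holds (.neg f) t}, ∅⟩
  | goal : PlanningRule T Δ n ⟨some .goal, {x | ∃ l ∈ Δ, x = .holds l n}, ∅⟩

/-- The ground rules evaluating formulas. Times range over `0, …, n`. -/
inductive FormulaRule (n : ℕ) : Rule (Atom σ π) → Prop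
  | formula_lit (l : Lit σ) : FormulaRule n ⟨some (.formula (litLabel l)), {.literal l}, ∅⟩
  | lit (l : Lit σ) (t : ℕ) : t ≤ n →
      FormulaRule n ⟨some (.hf (litLabel l) t), {.literal l, .holds l t}, ∅⟩
  | conj (N N₁ N₂ : Label σ π) (t : ℕ) : t ≤ n →
      FormulaRule n
        ⟨some (.hf N t), {.formula N, .conj N N₁ N₂, .hf N₁ t, .hf N₂ t}, ∅⟩
  | disj_left (N N₁ N₂ : Label σ π) (t : ℕ) : t ≤ n →
      FormulaRule n ⟨some (.hf N t), {.formula N, .disj N N₁ N₂, .hf N₁ t}, ∅⟩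
  | disj_right (N N₁ N₂ : Label σ π) (t : ℕ) : t ≤ n →
      FormulaRule n ⟨some (.hf N t), {.formula N, .disj N N₁ N₂, .hf N₂ t}, ∅⟩
  | negation (N N₁ : Label σ π) (t : ℕ) : t ≤ n →
      FormulaRule n ⟨some (.hf N t), {.formula N, .negation N N₁}, {.hf N₁ t}⟩
  | until (N N₁ N₂ : Label σ π) (t t' : ℕ) : t ≤ t' → t' ≤ n →
      FormulaRule n
        ⟨some (.hf N t), {.formula N, .until N N₁ N₂, .hfDuring N₁ t t', .hf N₂ t'}, ∅⟩
  | always (N N₁ : Label σ π) (t : ℕ) : t ≤ n →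
      FormulaRule n ⟨some (.hf N t), {.formula N, .always N N₁, .hfDuring N₁ t n}, ∅⟩
  | eventually (N N₁ : Label σ π) (t t' : ℕ) : t ≤ t' → t' ≤ n →
      FormulaRule n ⟨some (.hf N t), {.formula N, .eventually N N₁, .hf N₁ t'}, ∅⟩
  | next (N N₁ : Label σ π) (t : ℕ) : t ≤ n →
      FormulaRule n ⟨some (.hf N t), {.formula N, .next N N₁, .hf N₁ (t + 1)}, ∅⟩
  | during_self (N : Label σ π) (t : ℕ) : t ≤ n →
      FormulaRule n ⟨some (.hfDuring N t t), {.hf N t}, ∅⟩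
  | during_step (N : Label σ π) (t t' : ℕ) : t < t' → t' ≤ n →
      FormulaRule n ⟨some (.hfDuring N t t'), {.hf N t, .hfDuring N (t + 1) t'}, ∅⟩

/-- The ground rules realizing the operational semantics of programs. Times range over
`0, …, n`. -/
inductive TransRule (n : ℕ) : Rule (Atom σ π) → Prop
  | act (a : GAction σ) (t : ℕ) : t ≤ n →
      TransRule n ⟨some (.trans (.act a) t (t + 1)), {.action a, .occ a t}, ∅⟩
  | test (F : Label σ π) (t : ℕ) : t ≤ n →
      TransRule n ⟨some (.trans F t t), {.formula F, .hf F t}, ∅⟩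
  | seq (N N₁ N₂ : Label σ π) (t₁ t' t₂ : ℕ) : t₁ ≤ t' → t' ≤ t₂ → t₂ ≤ n →
      TransRule n
        ⟨some (.trans N t₁ t₂), {.sequence N N₁ N₂, .trans N₁ t₁ t', .trans N₂ t' t₂}, ∅⟩
  | choice (N N₁ : Label σ π) (t₁ t₂ : ℕ) : t₁ ≤ t₂ → t₂ ≤ n →
      TransRule n
        ⟨some (.trans N t₁ t₂), {.choiceAction N, .inChoice N₁ N, .trans N₁ t₁ t₂}, ∅⟩
  | ite_true (N F N₁ N₂ : Label σ π) (t₁ t₂ : ℕ) : t₁ ≤ t₂ → t₂ ≤ n →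
      TransRule n
        ⟨some (.trans N t₁ t₂), {.ifThenElse N F N₁ N₂, .hf F t₁, .trans N₁ t₁ t₂}, ∅⟩
  | ite_false (N F N₁ N₂ : Label σ π) (t₁ t₂ : ℕ) : t₁ ≤ t₂ → t₂ ≤ n →
      TransRule n
        ⟨some (.trans N t₁ t₂), {.ifThenElse N F N₁ N₂, .trans N₂ t₁ t₂}, {.hf F t₁}⟩
  | loop_true (N F N₁ : Label σ π) (t₁ t' t₂ : ℕ) : t₁ < t' → t' ≤ t₂ → t₂ ≤ n →
      TransRule n
        ⟨some (.trans N t₁ t₂),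
          {.whileDo N F N₁, .hf F t₁, .trans N₁ t₁ t', .trans N t' t₂}, ∅⟩
  | loop_false (N F N₁ : Label σ π) (t : ℕ) : t ≤ n →
      TransRule n ⟨some (.trans N t t), {.whileDo N F N₁}, {.hf F t}⟩
  | pick (N N₁ : Label σ π) (t₁ t₂ : ℕ) : t₁ ≤ t₂ → t₂ ≤ n →
      TransRule n ⟨some (.trans N t₁ t₂), {.choiceArgs N N₁, .trans N₁ t₁ t₂}, ∅⟩
  | null (t : ℕ) : t ≤ n → TransRule n ⟨some (.trans .null t t), ∅, ∅⟩

end Rules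

/-- The logic program `Π^Golog_n`: the rules of `Π_n` (for a goal `Δ`), those for formulas and for
`trans`, the encoding of the program, and, in place of the goal constraint, the constraint
`⊥ ← not trans(n_p, 0, n)`. -/
def gologProgram {σ : Signature.{u}} {π : ProcNames.{v}} (T : ActionTheory σ)
    (Δ : Finset (Lit σ)) (P : Program σ π) (n : ℕ) : Set (Rule (Atom σ π)) :=
  {r | PlanningRule π T Δ n r} ∪ {r | FormulaRule π n r} ∪ {r | TransRule π n r} ∪
    {r | ∃ x ∈ P.facts, r = ⟨some x, ∅, ∅⟩} ∪
    {⟨none, ∅, {.trans (label P.procs P.body) 0 n}⟩}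

/-- `s_i(M)`, the set of the fluent literals `l` with `holds(l, i) ∈ M`. -/
def stateAt {σ : Signature.{u}} {π : ProcNames.{v}} (M : Set (Atom σ π)) (i : ℕ) : Set (Lit σ) :=
  {l | Atom.holds l i ∈ M}

end GologPlanning

open GologPlanning

namespace GologPlanning

universe u v

/-! ### Answer sets as derivability -/

/-! A set `M` is an answer set exactly when it consists of the atoms derivable by those rules whose
negative bodies avoid `M`, and no constraint is violated in `M` (`isAnswerSet_iff`). A derivable
atom is always supported by a rule, which allows inversion (`Derives.support`) and induction on
derivations (`Derives.support_induction`); `Program.factSpec` recovers from the encoding which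
complex action a name stands for.

Take any fixed point whose states are interpretations. There `hf` is truth, for encoded formulas
over the fluents of the theory (`hf_mem_iff`), and `trans` up to time `n` is unfolding of complex
actions (`traceOf_of_trans`, `trans_of_traceOf`). What remains is to match fixed points with
trajectories.

From an answer set to a trajectory: `nocc` excludes simultaneous actions, and literals at time `t +
1` come only from direct effects, inertia and static laws, so the next state is the required closure
(`stateAt_succ_isClosure`). Inertia passes completeness on from state to state, and the constraints
give consistency (`isTrajectory_stateAt`).

From a trajectory to an answer set: inertia and the pair `occ`, `nocc` recurse through negation, so
the extension of the predicates is guessed (`Intended`), and `M` is what can be derived against the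
guess. For `M` to be a fixed point, the guess has to agree with `M` only on atoms negated in rules
with a head; `IsRun.intended` and `IsRun.derives_of_neg` show this. The rules also act at time `n`,
where an executable action forces some action to occur, so the trajectory must first be continued to
time `n + 1` (`exists_isRun`). -/

/-- The atoms derivable by the rules of `Q` whose negative bodies are disjoint from `K`. -/
inductive Derives {α : Type*} (Q : Set (Rule α)) (K : Set α) : α → Prop
  | intro {x : α} {p m : Set α} : (⟨some x, p, m⟩ : Rule α) ∈ Q → Disjoint m K →
      (∀ y ∈ p, Derives Q K y) → Derives Q K x

/-- The reduct has no negation, so its smallest model is generated by forward derivation; rules with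
head `⊥` generate nothing and act only as a test on `M`. -/
theorem isAnswerSet_iff {α : Type*} {Q : Set (Rule α)} {M : Set α} :
    IsAnswerSet Q M ↔ (∀ x, x ∈ M ↔ Derives Q M x) ∧
      ∀ p m, (⟨none, p, m⟩ : Rule α) ∈ Q → p ⊆ M → ¬ Disjoint m M := by
  constructor
  · rintro ⟨h1, h2⟩
    have hcon : ∀ p m, (⟨none, p, m⟩ : Rule α) ∈ Q → p ⊆ M → ¬ Disjoint m M := by
      intro p m hr hp hm
      obtain ⟨h, hh, -⟩ := h1 ⟨none, p, ∅⟩ ⟨_, hr, hm, rfl⟩ hp (by simp)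
      simp at hh
    have hsub : ∀ x, Derives Q M x → x ∈ M := by
      intro x hx
      induction hx with
      | intro hr hm _ ih =>
        obtain ⟨h, hh, hM⟩ := h1 _ ⟨_, hr, hm, rfl⟩ ih (by simp)
        cases hh
        exact hM
    refine ⟨fun x => ⟨fun hx => ?_, hsub x⟩, hcon⟩
    -- Minimality of `M` is applied to the set of derivable atoms. It models the constraints too:
    -- being contained in `M`, it triggers none that `M` does not.
    refine h2 (a := {x | Derives Q M x}) ?_ hx
    rintro _ ⟨⟨h, p, m⟩, hr, hm, rfl⟩ hp -
    cases h with
    | none => exact absurd hm (hcon p m hr fun y hy => hsub y (hp hy))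
    | some x => exact ⟨x, rfl, .intro hr hm hp⟩
  · rintro ⟨h1, h2⟩
    refine ⟨?_, ?_⟩
    · rintro _ ⟨⟨h, p, m⟩, hr, hm, rfl⟩ hp -
      cases h with
      | none => exact absurd hm (h2 p m hr hp)
      | some x => exact ⟨x, rfl, (h1 x).2 (.intro hr hm fun y hy => (h1 y).1 (hp hy))⟩
    · intro Y hY x hx
      replace hx := (h1 x).1 hx
      induction hx with
      | intro hr hm _ ih =>
        obtain ⟨h, hh, hM⟩ := hY _ ⟨_, hr, hm, rfl⟩ ih (by simp)
        cases hh
        exact hM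

/-- Derivability depends on `K` only through the negative bodies of the rules. -/
theorem Derives.congr {α : Type*} {Q : Set (Rule α)} {K K' : Set α}
    (h : ∀ x p m, (⟨some x, p, m⟩ : Rule α) ∈ Q → ∀ y ∈ m, y ∈ K' → y ∈ K) {x : α}
    (hx : Derives Q K x) : Derives Q K' x := by
  induction hx with
  | intro hr hm _ ih =>
    exact .intro hr (Set.disjoint_left.2 fun y hy hy' =>
      Set.disjoint_left.1 hm hy (h _ _ _ hr y hy hy')) ih

/-! ### Literals and interpretations -/

/-- The contrary literal. -/
def Lit.compl {σ : Signature.{u}} : Lit σ → Lit σ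
  | .pos f => .neg f
  | .neg f => .pos f

@[simp]
theorem Lit.compl_fluent {σ : Signature.{u}} (l : Lit σ) : l.compl.fluent = l.fluent := by
  cases l <;> rfl

@[simp]
theorem Lit.compl_compl {σ : Signature.{u}} (l : Lit σ) : l.compl.compl = l := by
  cases l <;> rfl

theorem ConsistentLits.compl_notMem {σ : Signature.{u}} {s : Set (Lit σ)} (h : ConsistentLits s)
    {l : Lit σ} (hl : l ∈ s) : l.compl ∉ s := by
  cases l with
  | pos f => exact fun h' => h f ⟨hl, h'⟩
  | neg f => exact fun h' => h f ⟨h', hl⟩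

/-- If a literal and its contrary are both missing, the literal can be added consistently; so
maximality amounts to completeness. -/
theorem ActionTheory.isInterpretation_iff {σ : Signature.{u}} {T : ActionTheory σ}
    {s : Set (Lit σ)} : T.IsInterpretation s ↔
      s ⊆ T.literals ∧ ConsistentLits s ∧ ∀ l ∈ T.literals, l.compl ∉ s → l ∈ s := by
  constructor
  · rintro ⟨⟨h1, h2⟩, h3⟩
    refine ⟨h1, h2, fun l hl hc => ?_⟩
    refine h3 (y := insert l s) ⟨Set.insert_subset hl h1, ?_⟩ (Set.subset_insert l s)
      (Set.mem_insert l s)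
    rintro f ⟨hp, hn⟩
    rcases hp with rfl | hp
    · rcases hn with hn | hn
      · cases hn
      · exact hc hn
    · rcases hn with rfl | hn
      · exact hc hp
      · exact h2 f ⟨hp, hn⟩
  · rintro ⟨h1, h2, h3⟩
    refine ⟨⟨h1, h2⟩, fun w ⟨hw1, hw2⟩ hs l hl => h3 l (hw1 hl) fun hc => ?_⟩
    exact hw2.compl_notMem hl (hs hc)

/-! ### Decoding the facts of a program -/

section Facts

variable {σ : Signature.{u}} {π : ProcNames.{v}}

/-- The complex action to be unfolded in order to execute `δ`. -/
def core (S : Procedures σ π) : GCAction σ π → GCAction σ π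
  | .call p c => (S p).ground c
  | δ => δ

/-- Grounding keeps the outermost constructor, so the ban on nested procedures passes to ground
instances. -/
theorem Coherent.ground_ne_call {S : Procedures σ π} (hS : Coherent S) (p q : π.Name)
    (c : Fin (π.arity p) → σ.Obj) (d : Fin (π.arity q) → σ.Obj) :
    (S p).ground c ≠ .call q d := by
  have h := hS.2 p
  generalize S p = δ at h
  cases δ <;> simp only [CAction.ground, ne_eq, reduceCtorEq, not_false_eq_true]
  exact (h _ _ rfl).elim

/-- A name forgets only whether its complex action was reached through a call. Bodies are never
calls, so a single unfolding removes this ambiguity. -/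
theorem core_label {S : Procedures σ π} (hS : Coherent S) (δ : GCAction σ π) :
    core S (label S δ) = core S δ := by
  cases δ with
  | call p c =>
    have h := hS.ground_ne_call p
    simp only [label]
    split <;> simp_all [core]
  | _ => rfl

theorem TraceOf.of_core {S : Procedures σ π} {s : ℕ → Set (Lit σ)} {a : ℕ → GAction σ}
    {δ : GCAction σ π} {i j : ℕ} (h : TraceOf S s a (core S δ) i j) : TraceOf S s a δ i j := by
  cases δ with
  | call p c => exact .call h
  | _ => exact h

/-- What the facts in the encoding of a program with the set `X` of facts tell. -/
def FactSpec (S : Procedures σ π) (X : Set (Atom σ π)) : Atom σ π → Prop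
  | .formula N => ∃ φ : GFormula σ, N = .test φ ∧ φ.facts π ⊆ X
  | .conj N N₁ N₂ => ∃ φ ψ : GFormula σ, N = .test (.and φ ψ) ∧ N₁ = .test φ ∧ N₂ = .test ψ ∧
      .formula N ∈ X
  | .disj N N₁ N₂ => ∃ φ ψ : GFormula σ, N = .test (.or φ ψ) ∧ N₁ = .test φ ∧ N₂ = .test ψ ∧
      .formula N ∈ X
  | .negation N N₁ => ∃ φ : GFormula σ, (∀ f, φ ≠ .atom f) ∧ N = .test (.neg φ) ∧ N₁ = .test φ ∧
      .formula N ∈ X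
  | .sequence N N₁ N₂ => ∃ δ₁ δ₂, core S N = .seq δ₁ δ₂ ∧ N₁ = label S δ₁ ∧ N₂ = label S δ₂
  | .choiceAction _ => True
  | .inChoice N₁ N => ∃ m δ i, core S N = .choice m δ ∧ N₁ = label S (δ i)
  | .ifThenElse N F N₁ N₂ => ∃ φ δ₁ δ₂, core S N = .ite φ δ₁ δ₂ ∧ F = .test φ ∧
      φ.facts π ⊆ X ∧ N₁ = label S δ₁ ∧ N₂ = label S δ₂
  | .whileDo N F N₁ => ∃ φ δ, core S N = .loop φ δ ∧ F = .test φ ∧ φ.facts π ⊆ X ∧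
      N₁ = label S δ
  | .choiceArgs N N₁ => ∃ cs δ, ∃ y ∈ cs, core S N = .pick cs δ ∧ N₁ = label S (δ y)
  | _ => False

theorem factSpec_of_mem_facts {S : Procedures σ π} {X : Set (Atom σ π)} {φ : GFormula σ}
    (hX : φ.facts π ⊆ X) {x : Atom σ π} (hx : x ∈ φ.facts π) : FactSpec S X x := by
  induction φ with
  | atom f => exact hx.elim
  | and φ ψ ih₁ ih₂ =>
    have hX' := hX
    simp only [GFormula.facts, Set.union_subset_iff] at hX
    rcases hx with (hx | hx) | rfl | rfl
    · exact ih₁ hX.1.1 hx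
    · exact ih₂ hX.1.2 hx
    · exact ⟨_, rfl, hX'⟩
    · exact ⟨_, _, rfl, rfl, rfl, hX.2 (by simp)⟩
  | or φ ψ ih₁ ih₂ =>
    have hX' := hX
    simp only [GFormula.facts, Set.union_subset_iff] at hX
    rcases hx with (hx | hx) | rfl | rfl
    · exact ih₁ hX.1.1 hx
    · exact ih₂ hX.1.2 hx
    · exact ⟨_, rfl, hX'⟩
    · exact ⟨_, _, rfl, rfl, rfl, hX.2 (by simp)⟩
  | neg φ ih =>
    have hX' := hX
    simp only [GFormula.facts, Set.union_subset_iff] at hX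
    rcases hx with hx | hx
    · exact ih hX.1 hx
    · cases φ with
      | atom f => exact hx.elim
      | _ =>
        rcases hx with rfl | rfl
        · exact ⟨_, rfl, hX'⟩
        · exact ⟨_, by simp, rfl, rfl, hX.2 (by simp)⟩

theorem core_label_self {S : Procedures σ π} (hS : Coherent S) {δ : GCAction σ π}
    (h : ∀ p c, δ ≠ .call p c) : core S (label S δ) = δ := by
  rw [core_label hS]
  cases δ with
  | call p c => exact absurd rfl (h p c)
  | _ => rfl

/-- The superset `X` stays fixed during the induction, so that it can later be the set of all facts
of the program. Calls need no condition on `N`, as they contribute no facts. -/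
theorem factSpec_of_mem_encode {S : Procedures σ π} (hS : Coherent S) {X : Set (Atom σ π)}
    {δ : GCAction σ π} {N : Label σ π} (hN : (∀ p c, δ ≠ .call p c) → core S N = δ)
    (hX : encode S N δ ⊆ X) {x : Atom σ π} (hx : x ∈ encode S N δ) : FactSpec S X x := by
  induction δ generalizing N with
  | act a => exact hx.elim
  | test φ => exact factSpec_of_mem_facts hX hx
  | seq δ₁ δ₂ ih₁ ih₂ =>
    replace hN := hN (by simp)
    simp only [encode, Set.union_subset_iff] at hX
    rcases hx with (rfl | hx) | hx
    · exact ⟨_, _, hN, rfl, rfl⟩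
    · exact ih₁ (core_label_self hS) hX.1.2 hx
    · exact ih₂ (core_label_self hS) hX.2 hx
  | choice m δ ih =>
    replace hN := hN (by simp)
    simp only [encode, Set.union_subset_iff, Set.iUnion_subset_iff] at hX
    rcases hx with (rfl | ⟨i, rfl⟩) | hx
    · trivial
    · exact ⟨_, _, _, hN, rfl⟩
    · obtain ⟨i, hi⟩ := Set.mem_iUnion.1 hx
      exact ih i (core_label_self hS) (hX.2 i) hi
  | ite φ δ₁ δ₂ ih₁ ih₂ =>
    replace hN := hN (by simp)
    simp only [encode, Set.union_subset_iff] at hX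
    rcases hx with ((rfl | hx) | hx) | hx
    · exact ⟨_, _, _, hN, rfl, hX.1.1.2, rfl, rfl⟩
    · exact factSpec_of_mem_facts hX.1.1.2 hx
    · exact ih₁ (core_label_self hS) hX.1.2 hx
    · exact ih₂ (core_label_self hS) hX.2 hx
  | loop φ δ ih =>
    replace hN := hN (by simp)
    simp only [encode, Set.union_subset_iff] at hX
    rcases hx with (rfl | hx) | hx
    · exact ⟨_, _, hN, rfl, hX.1.2, rfl⟩
    · exact factSpec_of_mem_facts hX.1.2 hx
    · exact ih (core_label_self hS) hX.2 hx
  | pick cs δ ih =>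
    replace hN := hN (by simp)
    simp only [encode, Set.union_subset_iff, Set.iUnion_subset_iff] at hX
    rcases hx with ⟨y, hy, rfl⟩ | hx
    · exact ⟨_, _, y, hy, hN, rfl⟩
    · simp only [Set.mem_iUnion] at hx
      obtain ⟨y, hy, hx⟩ := hx
      exact ih y (core_label_self hS) (hX.2 y hy) hx
  | call p c => exact hx.elim
  | null => exact hx.elim

theorem Program.encode_body_subset_facts (P : Program σ π) :
    encode P.procs (label P.procs P.body) P.body ⊆ P.facts :=
  Set.subset_union_left

theorem Program.encode_proc_subset_facts (P : Program σ π) (p : π.Name)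
    (c : Fin (π.arity p) → σ.Obj) :
    encode P.procs (label P.procs (.call p c)) ((P.procs p).ground c) ⊆ P.facts :=
  fun _ hx => Or.inr (Set.mem_iUnion₂.2 ⟨p, c, hx⟩)

/-- A procedure body is encoded under the name of the call, whose `core` is that body. Hence complex
actions sharing a name cannot contribute conflicting facts. -/
theorem Program.factSpec (P : Program σ π) {x : Atom σ π} (hx : x ∈ P.facts) :
    FactSpec P.procs P.facts x := by
  have hx' := hx
  rcases hx' with h | h
  · exact factSpec_of_mem_encode P.coherent (core_label_self P.coherent)
      P.encode_body_subset_facts h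
  · obtain ⟨p, c, h⟩ := Set.mem_iUnion₂.1 h
    exact factSpec_of_mem_encode P.coherent (fun _ => core_label P.coherent _)
      (P.encode_proc_subset_facts p c) h

end Facts

/-! ### Supported atoms: inversion and induction for derivations -/

section Support

variable {σ : Signature.{u}} {π : ProcNames.{v}}

/-- The atom `x` is supported: it is the head of a rule of `gologProgram T Δ P n` whose positive
body has the property `G` and whose negative body is disjoint from `K` (the rules for temporal
operators are left out, since they do not apply). -/
def Support (T : ActionTheory σ) (P : Program σ π) (n : ℕ) (K : Set (Atom σ π))
    (G : Atom σ π → Prop) : Atom σ π → Prop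
  | .action a => a ∈ T.actions
  | .fluent f => f ∈ T.fluents
  | .time t => t ≤ n
  | .holds l t => (t = 0 ∧ l ∈ T.initial) ∨
      (t ≤ n ∧ ∃ r ∈ T.static, r.eff = l ∧ ∀ g ∈ r.pre, G (.holds g t)) ∨
      ∃ k ≤ n, t = k + 1 ∧
        ((∃ r ∈ T.dynamic, r.eff = l ∧ G (.occ r.act k) ∧ ∀ g ∈ r.pre, G (.holds g k)) ∨
          (G (.literal l) ∧ G (.holds l k) ∧ .holds l.compl t ∉ K))
  | .possible a t => t ≤ n ∧ ∃ r ∈ T.exec, r.act = a ∧ ∀ g ∈ r.pre, G (.holds g t)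
  | .occ a t => t ≤ n ∧ G (.action a) ∧ G (.possible a t) ∧ .nocc a t ∉ K
  | .nocc a t => t ≤ n ∧ G (.action a) ∧ ∃ b, a ≠ b ∧ G (.occ b t)
  | .literal l => G (.fluent l.fluent)
  | .contrary l g => g = l.compl
  | .goal => True
  | .formula N => (∃ l, N = litLabel l ∧ G (.literal l)) ∨ .formula N ∈ P.facts
  | .hf N t => t ≤ n ∧
      ((∃ l, N = litLabel l ∧ G (.literal l) ∧ G (.holds l t)) ∨
        (∃ N₁ N₂, .conj N N₁ N₂ ∈ P.facts ∧ G (.hf N₁ t) ∧ G (.hf N₂ t)) ∨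
        (∃ N₁ N₂, .disj N N₁ N₂ ∈ P.facts ∧ (G (.hf N₁ t) ∨ G (.hf N₂ t))) ∨
        ∃ N₁, .negation N N₁ ∈ P.facts ∧ .hf N₁ t ∉ K)
  | .hfDuring _ _ _ => True
  | .trans N i j => i ≤ n ∧
      ((∃ a, N = .act a ∧ j = i + 1 ∧ G (.occ a i)) ∨
        (i = j ∧ G (.formula N) ∧ G (.hf N i)) ∨
        (∃ N₁ N₂ k, i ≤ k ∧ k ≤ j ∧ .sequence N N₁ N₂ ∈ P.facts ∧
          G (.trans N₁ i k) ∧ G (.trans N₂ k j)) ∨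
        (∃ N₁, .inChoice N₁ N ∈ P.facts ∧ G (.trans N₁ i j)) ∨
        (∃ F N₁ N₂, .ifThenElse N F N₁ N₂ ∈ P.facts ∧ G (.hf F i) ∧ G (.trans N₁ i j)) ∨
        (∃ F N₁ N₂, .ifThenElse N F N₁ N₂ ∈ P.facts ∧ .hf F i ∉ K ∧ G (.trans N₂ i j)) ∨
        (∃ F N₁ k, i < k ∧ k ≤ j ∧ .whileDo N F N₁ ∈ P.facts ∧ G (.hf F i) ∧
          G (.trans N₁ i k) ∧ G (.trans N k j)) ∨
        (i = j ∧ ∃ F N₁, .whileDo N F N₁ ∈ P.facts ∧ .hf F i ∉ K) ∨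
        (∃ N₁, .choiceArgs N N₁ ∈ P.facts ∧ G (.trans N₁ i j)) ∨
        (i = j ∧ N = .null))
  | x => x ∈ P.facts

variable {T : ActionTheory σ} {Δ : Finset (Lit σ)} {P : Program σ π} {n : ℕ}
  {K : Set (Atom σ π)}

/-- The atoms that occur as heads of facts only. -/
def IsFactAtom : Atom σ π → Prop
  | .conj _ _ _ | .disj _ _ _ | .negation _ _ | .until _ _ _ | .always _ _ | .eventually _ _
  | .next _ _ | .sequence _ _ _ | .choiceAction _ | .inChoice _ _ | .ifThenElse _ _ _ _
  | .whileDo _ _ _ | .choiceArgs _ _ => True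
  | _ => False

theorem Derives.mem_facts {x : Atom σ π} (h : Derives (gologProgram T Δ P n) K x)
    (hx : IsFactAtom x) : x ∈ P.facts := by
  obtain ⟨hr, -, -⟩ := h
  rcases hr with (((hr | hr) | hr) | ⟨y, hy, hr⟩) | hr
  · cases hr <;> exact hx.elim
  · cases hr <;> exact hx.elim
  · cases hr <;> exact hx.elim
  · obtain ⟨rfl, -, -⟩ := by simpa using hr
    exact hy
  · simp at hr

theorem Derives.contrary_eq {l g : Lit σ}
    (h : Derives (gologProgram T Δ P n) K (.contrary l g)) : g = l.compl := by
  obtain ⟨hr, -, -⟩ := h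
  rcases hr with (((hr | hr) | hr) | ⟨y, hy, hr⟩) | hr
  · cases hr <;> rfl
  · cases hr
  · cases hr
  · obtain ⟨rfl, -, -⟩ := by simpa using hr
    exact (P.factSpec hy).elim
  · simp at hr

/-- The head of a program rule is supported by any property of derivable atoms that contains the
positive body. -/
theorem support_of_rule {G : Atom σ π → Prop}
    (hG : ∀ y, G y → Derives (gologProgram T Δ P n) K y)
    {x : Atom σ π} {p m : Set (Atom σ π)} (hr : ⟨some x, p, m⟩ ∈ gologProgram T Δ P n)
    (hm : Disjoint m K) (hp : ∀ y ∈ p, G y) : Support T P n K G x := by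
  rcases hr with (((hr | hr) | hr) | ⟨y, hy, hr⟩) | hr
  · cases hr with
    | action a h => exact h
    | fluent a h => exact h
    | time a h => exact h
    | initially l h => exact Or.inl ⟨rfl, h⟩
    | executable r t h ht => exact ⟨ht, r, h, rfl, fun g hg => hp _ (Or.inr ⟨g, hg, rfl⟩)⟩
    | causes r t h ht =>
      exact Or.inr (Or.inr ⟨t, ht, rfl, Or.inl ⟨r, h, rfl, hp _ (by simp),
        fun g hg => hp _ (Or.inr ⟨g, hg, rfl⟩)⟩⟩)
    | caused r t h ht =>
      exact Or.inr (Or.inl ⟨ht, r, h, rfl, fun g hg => hp _ (Or.inr ⟨g, hg, rfl⟩)⟩)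
    | occ a t ht => exact ⟨ht, hp _ (by simp), hp _ (by simp), Set.disjoint_singleton_left.1 hm⟩
    | nocc a b t h ht => exact ⟨ht, hp _ (by simp), b, h, hp _ (by simp)⟩
    | literal_pos f => exact hp _ rfl
    | literal_neg f => exact hp _ rfl
    | contrary_pos f => exact rfl
    | contrary_neg f => exact rfl
    | inertia l g t ht =>
      -- The rule mentions two independent literals; only the derivability of the `contrary` atom
      -- ties the second to the first.
      obtain rfl := (hG _ (hp (.contrary l g) (by simp))).contrary_eq
      exact Or.inr (Or.inr ⟨t, ht, rfl, Or.inr ⟨hp _ (by simp), hp _ (by simp),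
        Set.disjoint_singleton_left.1 hm⟩⟩)
    | goal => trivial
  · cases hr with
    | formula_lit l => exact Or.inl ⟨l, rfl, hp _ rfl⟩
    | lit l t ht => exact ⟨ht, Or.inl ⟨l, rfl, hp _ (by simp), hp _ (by simp)⟩⟩
    | conj N N₁ N₂ t ht =>
      exact ⟨ht, Or.inr (Or.inl ⟨N₁, N₂, (hG _ (hp _ (by simp))).mem_facts trivial, hp _ (by simp),
        hp _ (by simp)⟩)⟩
    | disj_left N N₁ N₂ t ht =>
      exact ⟨ht, Or.inr (Or.inr (Or.inl ⟨N₁, N₂, (hG _ (hp _ (by simp))).mem_facts trivial,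
        Or.inl (hp _ (by simp))⟩))⟩
    | disj_right N N₁ N₂ t ht =>
      exact ⟨ht, Or.inr (Or.inr (Or.inl ⟨N₁, N₂, (hG _ (hp _ (by simp))).mem_facts trivial,
        Or.inr (hp _ (by simp))⟩))⟩
    | negation N N₁ t ht =>
      exact ⟨ht, Or.inr (Or.inr (Or.inr ⟨N₁, (hG _ (hp _ (by simp))).mem_facts trivial,
        Set.disjoint_singleton_left.1 hm⟩))⟩
    | always N N₁ t ht =>
      -- Programs contain no temporal operators: `FactSpec` is `False` on such atoms, so these rules
      -- never fire.
      exact (P.factSpec ((hG (.always N N₁) (hp _ (by simp))).mem_facts trivial)).elim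
    | eventually N N₁ t t' h ht =>
      exact (P.factSpec ((hG (.eventually N N₁) (hp _ (by simp))).mem_facts trivial)).elim
    | next N N₁ t ht =>
      exact (P.factSpec ((hG (.next N N₁) (hp _ (by simp))).mem_facts trivial)).elim
    | during_self N t ht => trivial
    | during_step N t t' h ht => trivial
    -- Only the rule for `until` is left; its fact atom is the second in the body.
    | _ => exact (P.factSpec ((hG _ (hp _ (Or.inr (Or.inl rfl)))).mem_facts trivial)).elim
  · cases hr with
    | act a t ht => exact ⟨ht, Or.inl ⟨a, rfl, rfl, hp _ (by simp)⟩⟩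
    | test F t ht => exact ⟨ht, Or.inr (Or.inl ⟨rfl, hp _ (by simp), hp _ (by simp)⟩)⟩
    | seq N N₁ N₂ t₁ t' t₂ h₁ h₂ ht =>
      exact ⟨by omega, Or.inr (Or.inr (Or.inl ⟨N₁, N₂, t', h₁, h₂, (hG _ (hp _ (by simp))).mem_facts trivial,
        hp _ (by simp), hp _ (by simp)⟩))⟩
    | choice N N₁ t₁ t₂ h ht =>
      exact ⟨by omega, Or.inr (Or.inr (Or.inr (Or.inl ⟨N₁, (hG _ (hp _ (by simp))).mem_facts trivial,
        hp _ (by simp)⟩)))⟩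
    | ite_true N F N₁ N₂ t₁ t₂ h ht =>
      exact ⟨by omega, Or.inr (Or.inr (Or.inr (Or.inr (Or.inl ⟨F, N₁, N₂,
        (hG _ (hp _ (by simp))).mem_facts trivial, hp _ (by simp), hp _ (by simp)⟩))))⟩
    | ite_false N F N₁ N₂ t₁ t₂ h ht =>
      exact ⟨by omega, Or.inr (Or.inr (Or.inr (Or.inr (Or.inr (Or.inl ⟨F, N₁, N₂,
        (hG _ (hp _ (by simp))).mem_facts trivial, Set.disjoint_singleton_left.1 hm, hp _ (by simp)⟩)))))⟩
    | loop_true N F N₁ t₁ t' t₂ h₁ h₂ ht =>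
      exact ⟨by omega, Or.inr (Or.inr (Or.inr (Or.inr (Or.inr (Or.inr (Or.inl ⟨F, N₁, t', h₁, h₂,
        (hG _ (hp _ (by simp))).mem_facts trivial, hp _ (by simp), hp _ (by simp), hp _ (by simp)⟩))))))⟩
    | loop_false N F N₁ t ht =>
      exact ⟨by omega, Or.inr (Or.inr (Or.inr (Or.inr (Or.inr (Or.inr (Or.inr (Or.inl ⟨rfl, F, N₁,
        (hG _ (hp _ (by simp))).mem_facts trivial, Set.disjoint_singleton_left.1 hm⟩)))))))⟩
    | pick N N₁ t₁ t₂ h ht =>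
      exact ⟨by omega, Or.inr (Or.inr (Or.inr (Or.inr (Or.inr (Or.inr (Or.inr (Or.inr (Or.inl
        ⟨N₁, (hG _ (hp _ (by simp))).mem_facts trivial, hp _ (by simp)⟩))))))))⟩
    | null t ht =>
      exact ⟨ht, Or.inr (Or.inr (Or.inr (Or.inr (Or.inr (Or.inr (Or.inr (Or.inr (Or.inr
        ⟨rfl, rfl⟩))))))))⟩
  · obtain ⟨rfl, -, -⟩ : x = y ∧ p = ∅ ∧ m = ∅ := by simpa using hr
    have h := P.factSpec hy
    cases x with
    | formula N => exact Or.inr hy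
    | action | fluent | time | holds | possible | occ | nocc | literal | contrary | goal | hf |
      hfDuring | trans => exact h.elim
    | _ => exact hy
  · simp at hr

/-- Induction on derivations from `gologProgram`. -/
theorem Derives.support_induction {motive : Atom σ π → Prop}
    (ih : ∀ x, Support T P n K (fun y => Derives (gologProgram T Δ P n) K y ∧ motive y) x →
      motive x) {x : Atom σ π} (hx : Derives (gologProgram T Δ P n) K x) : motive x := by
  induction hx with
  | intro hr hm hp hmot =>
    exact ih _ (support_of_rule (fun _ h => h.1) hr hm fun y hy => ⟨hp y hy, hmot y hy⟩)

theorem Derives.support {x : Atom σ π} (hx : Derives (gologProgram T Δ P n) K x) :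
    Support T P n K (fun y => Derives (gologProgram T Δ P n) K y) x := by
  obtain ⟨hr, hm, hp⟩ := hx
  exact support_of_rule (fun _ h => h) hr hm hp

end Support

/-! ### Forward derivation by single rules -/

section Rules

variable {σ : Signature.{u}} {π : ProcNames.{v}} {T : ActionTheory σ} {Δ : Finset (Lit σ)}
  {P : Program σ π} {n : ℕ} {K M : Set (Atom σ π)}

theorem Derives.of_planningRule {x : Atom σ π} {p m : Set (Atom σ π)}
    (hr : PlanningRule π T Δ n ⟨some x, p, m⟩) (hm : Disjoint m K)
    (hp : ∀ y ∈ p, Derives (gologProgram T Δ P n) K y) : Derives (gologProgram T Δ P n) K x :=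
  .intro (Or.inl (Or.inl (Or.inl (Or.inl hr)))) hm hp

theorem Derives.of_formulaRule {x : Atom σ π} {p m : Set (Atom σ π)}
    (hr : FormulaRule π n ⟨some x, p, m⟩) (hm : Disjoint m K)
    (hp : ∀ y ∈ p, Derives (gologProgram T Δ P n) K y) : Derives (gologProgram T Δ P n) K x :=
  .intro (Or.inl (Or.inl (Or.inl (Or.inr hr)))) hm hp

theorem Derives.of_transRule {x : Atom σ π} {p m : Set (Atom σ π)}
    (hr : TransRule π n ⟨some x, p, m⟩) (hm : Disjoint m K)
    (hp : ∀ y ∈ p, Derives (gologProgram T Δ P n) K y) : Derives (gologProgram T Δ P n) K x :=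
  .intro (Or.inl (Or.inl (Or.inr hr))) hm hp

theorem Derives.of_mem_facts {x : Atom σ π} (hx : x ∈ P.facts) :
    Derives (gologProgram T Δ P n) K x :=
  .intro (Or.inl (Or.inr ⟨x, hx, rfl⟩)) (by simp) (by simp)

theorem Derives.time {t : ℕ} (ht : t ≤ n) : Derives (gologProgram T Δ P n) K (.time t) :=
  .of_planningRule (.time t ht) (by simp) (by simp)

theorem Derives.action {a : GAction σ} (ha : a ∈ T.actions) :
    Derives (gologProgram T Δ P n) K (.action a) :=
  .of_planningRule (.action a ha) (by simp) (by simp)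

theorem Derives.fluent {f : GFluent σ} (hf : f ∈ T.fluents) :
    Derives (gologProgram T Δ P n) K (.fluent f) :=
  .of_planningRule (.fluent f hf) (by simp) (by simp)

theorem Derives.literal {l : Lit σ} (hl : l ∈ T.literals) :
    Derives (gologProgram T Δ P n) K (.literal l) := by
  cases l with
  | pos f => exact .of_planningRule (.literal_pos f) (by simp) (by rintro _ rfl; exact fluent hl)
  | neg f => exact .of_planningRule (.literal_neg f) (by simp) (by rintro _ rfl; exact fluent hl)

theorem Derives.contrary {l : Lit σ} (hl : l ∈ T.literals) :
    Derives (gologProgram T Δ P n) K (.contrary l l.compl) := by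
  cases l with
  | pos f => exact .of_planningRule (.contrary_pos f) (by simp) (by rintro _ rfl; exact fluent hl)
  | neg f => exact .of_planningRule (.contrary_neg f) (by simp) (by rintro _ rfl; exact fluent hl)

theorem Derives.inertia {l : Lit σ} {t : ℕ} (ht : t ≤ n) (hl : l ∈ T.literals)
    (h : Derives (gologProgram T Δ P n) K (.holds l t)) (hK : .holds l.compl (t + 1) ∉ K) :
    Derives (gologProgram T Δ P n) K (.holds l (t + 1)) := by
  refine .of_planningRule (.inertia l l.compl t ht) (by simpa using hK) ?_
  rintro _ (rfl | rfl | rfl | rfl | rfl)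
  · exact literal hl
  · exact literal (by simpa [ActionTheory.literals] using hl)
  · exact time ht
  · exact contrary hl
  · exact h

theorem Derives.caused {r : StaticLaw σ} (hr : r ∈ T.static) {t : ℕ} (ht : t ≤ n)
    (h : ∀ l ∈ r.pre, Derives (gologProgram T Δ P n) K (.holds l t)) :
    Derives (gologProgram T Δ P n) K (.holds r.eff t) := by
  refine .of_planningRule (.caused r t hr ht) (by simp) ?_
  rintro _ (rfl | ⟨l, hl, rfl⟩)
  · exact time ht
  · exact h l hl

theorem Derives.causes {r : DynamicLaw σ} (hr : r ∈ T.dynamic) {t : ℕ} (ht : t ≤ n)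
    (ho : Derives (gologProgram T Δ P n) K (.occ r.act t))
    (h : ∀ l ∈ r.pre, Derives (gologProgram T Δ P n) K (.holds l t)) :
    Derives (gologProgram T Δ P n) K (.holds r.eff (t + 1)) := by
  refine .of_planningRule (.causes r t hr ht) (by simp) ?_
  rintro _ ((rfl | rfl | rfl) | ⟨l, hl, rfl⟩)
  · exact time ht
  · exact ho
  -- An occurring action is possible, because `occ` is derivable only through `possible`.
  · exact ho.support.2.2.1
  · exact h l hl

theorem Derives.possible {r : ExecLaw σ} (hr : r ∈ T.exec) {t : ℕ} (ht : t ≤ n)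
    (h : ∀ l ∈ r.pre, Derives (gologProgram T Δ P n) K (.holds l t)) :
    Derives (gologProgram T Δ P n) K (.possible r.act t) := by
  refine .of_planningRule (.executable r t hr ht) (by simp) ?_
  rintro _ (rfl | ⟨l, hl, rfl⟩)
  · exact time ht
  · exact h l hl

theorem Derives.occ {a : GAction σ} {t : ℕ} (ht : t ≤ n) (ha : a ∈ T.actions)
    (h : Derives (gologProgram T Δ P n) K (.possible a t)) (hK : .nocc a t ∉ K) :
    Derives (gologProgram T Δ P n) K (.occ a t) := by
  refine .of_planningRule (.occ a t ht) (by simpa using hK) ?_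
  rintro _ (rfl | rfl | rfl)
  · exact action ha
  · exact time ht
  · exact h

theorem Derives.nocc {a b : GAction σ} {t : ℕ} (ht : t ≤ n) (ha : a ∈ T.actions) (hab : a ≠ b)
    (h : Derives (gologProgram T Δ P n) K (.occ b t)) :
    Derives (gologProgram T Δ P n) K (.nocc a t) := by
  refine .of_planningRule (.nocc a b t hab ht) (by simp) ?_
  rintro _ (rfl | rfl | rfl | rfl)
  · exact action ha
  · exact h.support.2.1
  · exact time ht
  · exact h

theorem Derives.hf_litLabel {l : Lit σ} (hl : l ∈ T.literals) {t : ℕ} (ht : t ≤ n)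
    (h : Derives (gologProgram T Δ P n) K (.holds l t)) :
    Derives (gologProgram T Δ P n) K (.hf (litLabel l) t) := by
  refine .of_formulaRule (.lit l t ht) (by simp) ?_
  rintro _ (rfl | rfl)
  · exact literal hl
  · exact h

theorem Derives.hf_conj {N N₁ N₂ : Label σ π} (hN : .conj N N₁ N₂ ∈ P.facts) {t : ℕ} (ht : t ≤ n)
    (h₁ : Derives (gologProgram T Δ P n) K (.hf N₁ t))
    (h₂ : Derives (gologProgram T Δ P n) K (.hf N₂ t)) :
    Derives (gologProgram T Δ P n) K (.hf N t) := by
  refine .of_formulaRule (.conj N N₁ N₂ t ht) (by simp) ?_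
  obtain ⟨-, -, -, -, -, hN'⟩ := P.factSpec hN
  rintro _ (rfl | rfl | rfl | rfl)
  · exact of_mem_facts hN'
  · exact of_mem_facts hN
  · exact h₁
  · exact h₂

theorem Derives.hf_disj {N N₁ N₂ : Label σ π} (hN : .disj N N₁ N₂ ∈ P.facts) {t : ℕ} (ht : t ≤ n)
    (h : Derives (gologProgram T Δ P n) K (.hf N₁ t) ∨
      Derives (gologProgram T Δ P n) K (.hf N₂ t)) :
    Derives (gologProgram T Δ P n) K (.hf N t) := by
  obtain ⟨-, -, -, -, -, hN'⟩ := P.factSpec hN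
  rcases h with h | h
  · refine .of_formulaRule (.disj_left N N₁ N₂ t ht) (by simp) ?_
    rintro _ (rfl | rfl | rfl)
    exacts [of_mem_facts hN', of_mem_facts hN, h]
  · refine .of_formulaRule (.disj_right N N₁ N₂ t ht) (by simp) ?_
    rintro _ (rfl | rfl | rfl)
    exacts [of_mem_facts hN', of_mem_facts hN, h]

theorem Derives.hf_negation {N N₁ : Label σ π} (hN : .negation N N₁ ∈ P.facts) {t : ℕ}
    (ht : t ≤ n) (h : .hf N₁ t ∉ K) : Derives (gologProgram T Δ P n) K (.hf N t) := by
  obtain ⟨-, -, -, -, hN'⟩ := P.factSpec hN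
  refine .of_formulaRule (.negation N N₁ t ht) (by simpa using h) ?_
  rintro _ (rfl | rfl)
  exacts [of_mem_facts hN', of_mem_facts hN]

theorem Derives.formula {φ : GFormula σ} (hφ : φ.fluents ⊆ T.fluents) (hX : φ.facts π ⊆ P.facts) :
    Derives (gologProgram T Δ P n) K (.formula (.test φ)) := by
  have key : ∀ l : Lit σ, l ∈ T.literals →
      Derives (gologProgram T Δ P n) K (.formula (litLabel l)) := fun l hl =>
    .of_formulaRule (.formula_lit l) (by simp) (by simpa using literal hl)
  cases φ with
  | atom f => exact key (.pos f) (hφ rfl)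
  | neg φ =>
    cases φ with
    | atom f => exact key (.neg f) (hφ rfl)
    | _ => exact of_mem_facts (hX (by simp [GFormula.facts]))
  | _ => exact of_mem_facts (hX (by simp [GFormula.facts]))

/-! ### Evaluation of formulas in fixed points -/

/-- The formula atoms of a fixed point express truth in its states. -/
theorem hf_mem_iff (hM : ∀ x, x ∈ M ↔ Derives (gologProgram T Δ P n) M x) {t : ℕ} (ht : t ≤ n)
    (hs : T.IsInterpretation (stateAt M t)) {φ : GFormula σ} (hφ : φ.fluents ⊆ T.fluents)
    (hX : φ.facts π ⊆ P.facts) : .hf (.test φ) t ∈ M ↔ φ.Holds (stateAt M t) := by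
  obtain ⟨hs1, hs2, hs3⟩ := ActionTheory.isInterpretation_iff.1 hs
  induction φ with
  | atom f =>
    rw [hM]
    constructor
    · intro h
      rcases h.support.2 with ⟨l, hl, -, hh⟩ | ⟨_, _, h, -⟩ | ⟨_, _, h, -⟩ | ⟨_, h, -⟩
      · cases l <;> cases hl
        exact (hM _).2 hh
      · obtain ⟨_, _, e, -⟩ := P.factSpec h
        cases e
      · obtain ⟨_, _, e, -⟩ := P.factSpec h
        cases e
      · obtain ⟨_, _, e, -⟩ := P.factSpec h
        cases e
    · exact fun h => .hf_litLabel (l := .pos f) (hφ rfl) ht ((hM _).1 h)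
  | and φ ψ ih₁ ih₂ =>
    simp only [GFormula.facts, Set.union_subset_iff] at hX
    simp only [GFormula.fluents, Set.union_subset_iff] at hφ
    simp only [GFormula.Holds, ← ih₁ hφ.1 hX.1.1, ← ih₂ hφ.2 hX.1.2]
    rw [hM, hM (.hf (.test φ) t), hM (.hf (.test ψ) t)]
    constructor
    · intro h
      rcases h.support.2 with ⟨l, hl, -, hh⟩ | ⟨_, _, h, h'⟩ | ⟨_, _, h, -⟩ | ⟨_, h, -⟩
      · cases l <;> cases hl
      · obtain ⟨_, _, e, rfl, rfl, -⟩ := P.factSpec h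
        cases e
        exact h'
      · obtain ⟨_, _, e, -⟩ := P.factSpec h
        cases e
      · obtain ⟨_, _, e, -⟩ := P.factSpec h
        cases e
    · exact fun h => .hf_conj (hX.2 (by simp)) ht h.1 h.2
  | or φ ψ ih₁ ih₂ =>
    simp only [GFormula.facts, Set.union_subset_iff] at hX
    simp only [GFormula.fluents, Set.union_subset_iff] at hφ
    simp only [GFormula.Holds, ← ih₁ hφ.1 hX.1.1, ← ih₂ hφ.2 hX.1.2]
    rw [hM, hM (.hf (.test φ) t), hM (.hf (.test ψ) t)]
    constructor
    · intro h
      rcases h.support.2 with ⟨l, hl, -, hh⟩ | ⟨_, _, h, h'⟩ | ⟨_, _, h, h'⟩ | ⟨_, h, -⟩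
      · cases l <;> cases hl
      · obtain ⟨_, _, e, -⟩ := P.factSpec h
        cases e
      · obtain ⟨_, _, e, rfl, rfl, -⟩ := P.factSpec h
        cases e
        exact h'
      · obtain ⟨_, _, e, -⟩ := P.factSpec h
        cases e
    · exact fun h => .hf_disj (hX.2 (by simp)) ht h
  | neg φ ih =>
    simp only [GFormula.facts, Set.union_subset_iff] at hX
    simp only [GFormula.Holds, ← ih hφ hX.1]
    constructor
    · intro h h'
      rcases ((hM _).1 h).support.2 with ⟨l, hl, -, hh⟩ | ⟨_, _, h, -⟩ | ⟨_, _, h, -⟩ | ⟨_, h, hK⟩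
      -- A negated atom is itself a fluent literal, evaluated through `holds` and not by negation as
      -- failure. Consistency of the state is therefore needed here, and its completeness in the
      -- converse.
      · cases l <;> cases hl
        rw [ih hφ hX.1] at h'
        exact hs2 _ ⟨h', (hM _).2 hh⟩
      · obtain ⟨_, _, e, -⟩ := P.factSpec h
        cases e
      · obtain ⟨_, _, e, -⟩ := P.factSpec h
        cases e
      · obtain ⟨_, _, e, rfl, -⟩ := P.factSpec h
        cases e
        exact hK h'
    · intro h
      rw [hM]
      cases φ with
      | atom f =>
        refine .hf_litLabel (l := .neg f) (hφ rfl) ht ((hM _).1 (hs3 (.neg f) (hφ rfl) fun h' => ?_))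
        exact h ((ih hφ hX.1).2 h')
      | _ => exact .hf_negation (hX.2 (by simp)) ht h

/-- The rule for tests fires for every name derived to be a formula. This supplies the encoding that
`hf_mem_iff` then requires; fluent literals need no facts. -/
theorem formula_facts_subset {φ : GFormula σ}
    (h : Derives (gologProgram T Δ P n) K (.formula (.test φ))) : φ.facts π ⊆ P.facts := by
  rcases h.support with ⟨l, hl, -⟩ | h
  · cases l <;> cases hl
    · exact Set.empty_subset _
    · exact Set.union_subset (Set.empty_subset _) (Set.empty_subset _)
  · obtain ⟨_, e, h'⟩ := P.factSpec h
    cases e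
    exact h'

/-! ### The transition atoms and the traces of programs -/

/-- The formulas on which the execution of `δ` depends are built from fluents of `T`. -/
def OverFluents (T : ActionTheory σ) (S : Procedures σ π) (δ : GCAction σ π) : Prop :=
  ∀ φ : GFormula σ, Prim S δ (.test φ) → φ.fluents ⊆ T.fluents

theorem OverFluents.core_of {S : Procedures σ π} {δ : GCAction σ π} (h : OverFluents T S δ) :
    OverFluents T S (core S δ) := by
  cases δ with
  | call p c => exact fun φ hφ => h φ (.call_body hφ)
  | _ => exact h

theorem OverFluents.core_label_of {S : Procedures σ π} (hS : Coherent S) {δ : GCAction σ π}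
    (h : OverFluents T S δ) : OverFluents T S (core S (label S δ)) :=
  core_label hS δ ▸ h.core_of

/-- Derivable transitions are traces. -/
theorem traceOf_of_trans (hM : ∀ x, x ∈ M ↔ Derives (gologProgram T Δ P n) M x)
    (hs : ∀ t ≤ n, T.IsInterpretation (stateAt M t)) {a : ℕ → GAction σ}
    (ha : ∀ t < n, ∀ b, .occ b t ∈ M → b = a t) {N : Label σ π} {i j : ℕ}
    (h : .trans N i j ∈ M) (hj : j ≤ n) (hN : OverFluents T P.procs (core P.procs N)) :
    TraceOf P.procs (stateAt M) a (core P.procs N) i j := by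
  have hS := P.coherent
  -- A name determines a complex action only up to unfolding a call, so the induction speaks of
  -- `core` of names; this passes back to the components themselves.
  have hsub : ∀ {δ : GCAction σ π} {i j : ℕ},
      TraceOf P.procs (stateAt M) a (core P.procs (label P.procs δ)) i j →
        TraceOf P.procs (stateAt M) a δ i j := fun h => .of_core (core_label hS _ ▸ h)
  suffices H : ∀ x : Atom σ π, Derives (gologProgram T Δ P n) M x → ∀ N i j, x = .trans N i j →
      j ≤ n → OverFluents T P.procs (core P.procs N) →
      TraceOf P.procs (stateAt M) a (core P.procs N) i j from
    H _ ((hM _).1 h) _ _ _ rfl hj hN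
  clear h hj hN N i j
  intro x hx
  refine Derives.support_induction (motive := fun x => ∀ N i j, x = .trans N i j →
      j ≤ n → OverFluents T P.procs (core P.procs N) →
      TraceOf P.procs (stateAt M) a (core P.procs N) i j) ?_ hx
  rintro x hx N i j rfl hj hN
  obtain ⟨hi, hx⟩ := hx
  rcases hx with ⟨b, rfl, rfl, hb, -⟩ | ⟨rfl, ⟨hF, -⟩, hf, -⟩ |
    ⟨N₁, N₂, k, hik, hkj, hf, ⟨-, h₁⟩, -, h₂⟩ | ⟨N₁, hf, -, h₁⟩ |
    ⟨F, N₁, N₂, hf, ⟨hF, -⟩, -, h₁⟩ | ⟨F, N₁, N₂, hf, hF, -, h₁⟩ |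
    ⟨F, N₁, k, hik, hkj, hf, ⟨hF, -⟩, ⟨-, h₁⟩, -, h₂⟩ | ⟨rfl, F, N₁, hf, hF⟩ |
    ⟨N₁, hf, -, h₁⟩ | ⟨rfl, rfl⟩
  · rw [ha i hj b ((hM _).2 hb)]
    exact .act i
  · obtain ⟨φ, rfl⟩ : ∃ φ, N = .test φ := by
      rcases hF.support with ⟨l, rfl, -⟩ | h
      · exact ⟨_, rfl⟩
      · obtain ⟨φ, h, -⟩ := P.factSpec h
        exact ⟨φ, h⟩
    exact .test i ((hf_mem_iff hM hj (hs i hj) (hN φ (.test φ))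
      (formula_facts_subset hF)).1 ((hM _).2 hf))
  · obtain ⟨δ₁, δ₂, hc, rfl, rfl⟩ := P.factSpec hf
    rw [hc] at hN ⊢
    have o₁ : OverFluents T P.procs δ₁ := fun φ h => hN φ (.seq_left h)
    have o₂ : OverFluents T P.procs δ₂ := fun φ h => hN φ (.seq_right h)
    exact .seq hik hkj (hsub (h₁ _ _ _ rfl (hkj.trans hj) (o₁.core_label_of hS)))
      (hsub (h₂ _ _ _ rfl hj (o₂.core_label_of hS)))
  · obtain ⟨m, δ, l, hc, rfl⟩ := P.factSpec hf
    rw [hc] at hN ⊢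
    have o : OverFluents T P.procs (δ l) := fun φ h => hN φ (.choice l h)
    exact .choice l (hsub (h₁ _ _ _ rfl hj (o.core_label_of hS)))
  · obtain ⟨φ, δ₁, δ₂, hc, rfl, hX, rfl, rfl⟩ := P.factSpec hf
    rw [hc] at hN ⊢
    have o : OverFluents T P.procs δ₁ := fun φ h => hN φ (.ite_then h)
    rw [← hM, hf_mem_iff hM hi (hs i hi) (hN φ (.ite_cond φ δ₁ δ₂)) hX] at hF
    exact .ite_true hF (hsub (h₁ _ _ _ rfl hj (o.core_label_of hS)))
  · obtain ⟨φ, δ₁, δ₂, hc, rfl, hX, rfl, rfl⟩ := P.factSpec hf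
    rw [hc] at hN ⊢
    have o : OverFluents T P.procs δ₂ := fun φ h => hN φ (.ite_else h)
    rw [hf_mem_iff hM hi (hs i hi) (hN φ (.ite_cond φ δ₁ δ₂)) hX] at hF
    exact .ite_false hF (hsub (h₁ _ _ _ rfl hj (o.core_label_of hS)))
  · obtain ⟨φ, δ, hc, rfl, hX, rfl⟩ := P.factSpec hf
    -- The remaining iterations bear the same name `N`, so their hypothesis is used before `core
    -- P.procs N` is rewritten. The induction is on derivations, not on complex actions.
    have h₂ := h₂ _ _ _ rfl hj hN
    rw [hc] at hN h₂ ⊢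
    have o : OverFluents T P.procs δ := fun φ h => hN φ (.loop_body h)
    rw [← hM, hf_mem_iff hM hi (hs i hi) (hN φ (.loop_cond φ δ)) hX] at hF
    exact .loop_true hF hik hkj (hsub (h₁ _ _ _ rfl (hkj.trans hj) (o.core_label_of hS))) h₂
  · obtain ⟨φ, δ, hc, rfl, hX, rfl⟩ := P.factSpec hf
    rw [hc] at hN ⊢
    rw [hf_mem_iff hM hi (hs i hi) (hN φ (.loop_cond φ δ)) hX] at hF
    exact .loop_false i hF
  · obtain ⟨cs, δ, y, hy, hc, rfl⟩ := P.factSpec hf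
    rw [hc] at hN ⊢
    have o : OverFluents T P.procs (δ y) := fun φ h => hN φ (.pick y hy h)
    exact .pick y hy (hsub (h₁ _ _ _ rfl hj (o.core_label_of hS)))
  · exact .null i

/-- `N` may serve as the name of `δ` in the encoding of a program. -/
def NameFor (S : Procedures σ π) (N : Label σ π) : GCAction σ π → Prop
  | .act a => N = .act a
  | .test φ => N = .test φ
  | .call p c => N = label S (.call p c)
  | .null => N = .null
  | _ => True

theorem nameFor_label (S : Procedures σ π) (δ : GCAction σ π) : NameFor S (label S δ) δ := by
  cases δ <;> first | rfl | trivial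

/-- Actions, tests and `null` obtain `trans` atoms only under their own names. It is essential that
`label` keeps these names when they are procedure bodies. -/
theorem nameFor_label_call {S : Procedures σ π} (hS : Coherent S) (p : π.Name)
    (c : Fin (π.arity p) → σ.Obj) : NameFor S (label S (.call p c)) ((S p).ground c) := by
  have h := hS.ground_ne_call p
  simp only [label]
  split <;> rename_i hδ
  · rw [hδ]; rfl
  · rw [hδ]; rfl
  · rw [hδ]; rfl
  · cases hδ' : (S p).ground c <;> simp_all [NameFor]

/-- Traces are derivable transitions. -/
theorem trans_of_traceOf (hM : ∀ x, x ∈ M ↔ Derives (gologProgram T Δ P n) M x)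
    (hs : ∀ t ≤ n, T.IsInterpretation (stateAt M t)) {a : ℕ → GAction σ}
    (ha : ∀ t < n, .occ (a t) t ∈ M) {δ : GCAction σ π} {i j : ℕ}
    (h : TraceOf P.procs (stateAt M) a δ i j) (hj : j ≤ n) (ho : OverFluents T P.procs δ)
    {N : Label σ π} (hN : NameFor P.procs N δ) (hX : encode P.procs N δ ⊆ P.facts) :
    .trans N i j ∈ M := by
  have hS := P.coherent
  have hle : ∀ {δ i j}, TraceOf P.procs (stateAt M) a δ i j → i ≤ j := by
    intro δ i j h
    induction h <;> omega
  rw [hM]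
  induction h generalizing N with
  | act i =>
    subst hN
    have hocc := (hM _).1 (ha i hj)
    refine .of_transRule (.act (a i) i (by omega)) (by simp) ?_
    rintro _ (rfl | rfl)
    exacts [hocc.support.2.1, hocc]
  | @test φ i h =>
    subst hN
    refine .of_transRule (.test _ i hj) (by simp) ?_
    rintro _ (rfl | rfl)
    · exact .formula (ho φ (.test φ)) hX
    · exact (hM _).1 ((hf_mem_iff hM hj (hs i hj) (ho φ (.test φ)) hX).2 h)
  | @seq δ₁ δ₂ i k j hik hkj _ _ ih₁ ih₂ =>
    simp only [encode, Set.union_subset_iff] at hX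
    refine .of_transRule (.seq N (label P.procs δ₁) (label P.procs δ₂) i k j hik hkj hj) (by simp) ?_
    rintro _ (rfl | rfl | rfl)
    · exact .of_mem_facts (hX.1.1 rfl)
    · exact ih₁ (hkj.trans hj) (fun φ h => ho φ (.seq_left h)) (nameFor_label _ _) hX.1.2
    · exact ih₂ hj (fun φ h => ho φ (.seq_right h)) (nameFor_label _ _) hX.2
  | @choice m δ i j l h ih =>
    simp only [encode, Set.union_subset_iff, Set.iUnion_subset_iff] at hX
    refine .of_transRule (.choice N (label P.procs (δ l)) i j (hle h) hj) (by simp) ?_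
    rintro _ (rfl | rfl | rfl)
    · exact .of_mem_facts (hX.1.1 rfl)
    · exact .of_mem_facts (hX.1.2 ⟨l, rfl⟩)
    · exact ih hj (fun φ h => ho φ (.choice l h)) (nameFor_label _ _) (hX.2 l)
  | @ite_true φ δ₁ δ₂ i j hφ h ih =>
    simp only [encode, Set.union_subset_iff] at hX
    have hi := (hle h).trans hj
    refine .of_transRule (.ite_true N (.test φ) (label P.procs δ₁) (label P.procs δ₂) i j (hle h) hj) (by simp) ?_
    rintro _ (rfl | rfl | rfl)
    · exact .of_mem_facts (hX.1.1.1 rfl)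
    · exact (hM _).1 ((hf_mem_iff hM hi (hs i hi) (ho φ (.ite_cond φ δ₁ δ₂)) hX.1.1.2).2 hφ)
    · exact ih hj (fun φ h => ho φ (.ite_then h)) (nameFor_label _ _) hX.1.2
  | @ite_false φ δ₁ δ₂ i j hφ h ih =>
    simp only [encode, Set.union_subset_iff] at hX
    have hi := (hle h).trans hj
    rw [← hf_mem_iff hM hi (hs i hi) (ho φ (.ite_cond φ δ₁ δ₂)) hX.1.1.2] at hφ
    refine .of_transRule (.ite_false N (.test φ) (label P.procs δ₁) (label P.procs δ₂) i j (hle h) hj) (by simpa using hφ) ?_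
    rintro _ (rfl | rfl)
    · exact .of_mem_facts (hX.1.1.1 rfl)
    · exact ih hj (fun φ h => ho φ (.ite_else h)) (nameFor_label _ _) hX.2
  | @loop_false φ δ i hφ =>
    simp only [encode, Set.union_subset_iff] at hX
    rw [← hf_mem_iff hM hj (hs i hj) (ho φ (.loop_cond φ δ)) hX.1.2] at hφ
    refine .of_transRule (.loop_false N (.test φ) (label P.procs δ) i hj) (by simpa using hφ) ?_
    rintro _ rfl
    exact .of_mem_facts (hX.1.1 rfl)
  | @loop_true φ δ i k j hφ hik hkj _ _ ih₁ ih₂ =>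
    have hX' := hX
    simp only [encode, Set.union_subset_iff] at hX
    have hi : i ≤ n := by omega
    refine .of_transRule (.loop_true N (.test φ) (label P.procs δ) i k j hik hkj hj) (by simp) ?_
    rintro _ (rfl | rfl | rfl | rfl)
    · exact .of_mem_facts (hX.1.1 rfl)
    · exact (hM _).1 ((hf_mem_iff hM hi (hs i hi) (ho φ (.loop_cond φ δ)) hX.1.2).2 hφ)
    · exact ih₁ (hkj.trans hj) (fun φ h => ho φ (.loop_body h)) (nameFor_label _ _) hX.2
    -- The rest of the loop is the same complex action under the same name, so the undecomposed
    -- inclusion `hX'` is needed.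
    · exact ih₂ hj ho hN hX'
  | @pick cs δ i j y hy h ih =>
    simp only [encode, Set.union_subset_iff, Set.iUnion_subset_iff] at hX
    refine .of_transRule (.pick N (label P.procs (δ y)) i j (hle h) hj) (by simp) ?_
    rintro _ (rfl | rfl)
    · exact .of_mem_facts (hX.1 ⟨y, hy, rfl⟩)
    · exact ih hj (fun φ h => ho φ (.pick y hy h)) (nameFor_label _ _) (hX.2 y hy)
  | @call p c i j _ ih =>
    obtain rfl := hN
    -- The call encodes nothing; the facts about its body come from the procedure part of the
    -- program, under the same name.
    exact ih hj (fun φ h => ho φ (.call_body h)) (nameFor_label_call hS p c)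
      (P.encode_proc_subset_facts p c)
  | null i =>
    subst hN
    exact .of_transRule (.null i hj) (by simp) (by simp)

end Rules

/-! ### From answer sets to trajectories -/

section AnswerSetToTrace

variable {σ : Signature.{u}} {π : ProcNames.{v}} {T : ActionTheory σ} {Δ : Finset (Lit σ)}
  {P : Program σ π} {n : ℕ} {M : Set (Atom σ π)}

/-- In a fixed point at most one action occurs at a time. -/
theorem occ_unique (hM : ∀ x, x ∈ M ↔ Derives (gologProgram T Δ P n) M x) {a b : GAction σ}
    {t : ℕ} (ha : .occ a t ∈ M) (hb : .occ b t ∈ M) : b = a := by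
  by_contra hab
  rw [hM] at ha hb
  obtain ⟨ht, hact, -, hK⟩ := Derives.support ha
  exact hK ((hM _).2 (.nocc ht hact.support (Ne.symm hab) hb))

theorem ActionTheory.IsClosure.isState_of_complete {s u : Set (Lit σ)} (h : T.IsClosure u s)
    (hc : ∀ l ∈ T.literals, l.compl ∉ s → l ∈ s) : T.IsState s :=
  ⟨ActionTheory.isInterpretation_iff.2 ⟨h.1.1, h.1.2.1, hc⟩, h.1.2.2.2⟩

theorem stateAt_subset_literals (hT : ∀ l ∈ T.initial, l ∈ T.literals)
    (hM : ∀ x, x ∈ M ↔ Derives (gologProgram T Δ P n) M x) (t : ℕ) :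
    stateAt M t ⊆ T.literals := by
  intro l hl
  rcases ((hM _).1 hl).support with ⟨-, h⟩ | ⟨-, r, hr, rfl, -⟩ |
    ⟨k, -, -, ⟨r, hr, rfl, -⟩ | ⟨h, -⟩⟩
  · exact hT l h
  · exact (T.static_wf r hr).1
  · exact (T.dynamic_wf r hr).2.1
  -- `literal` is supported by `fluent`, and `fluent` by membership in the fluents of the theory.
  · exact Derives.support (Derives.support h)

theorem stateAt_consistent (hT : ∀ l ∈ T.initial, l ∈ T.literals)
    (hM : IsAnswerSet (gologProgram T Δ P n) M) {t : ℕ} (ht : t ≤ n) :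
    ConsistentLits (stateAt M t) := by
  obtain ⟨hM, hcon⟩ := isAnswerSet_iff.1 hM
  intro f hf
  refine hcon _ _ (Or.inl (Or.inl (Or.inl (Or.inl (.consistency f t ht))))) ?_ (by simp)
  rintro _ (rfl | rfl | rfl)
  · exact (hM _).2 (.fluent (stateAt_subset_literals hT hM t hf.1))
  · exact hf.1
  · exact hf.2

/-- At time `0` only the initial facts and the static laws produce literals, and the initial set is
already closed under the latter. -/
theorem stateAt_zero (hT : ClosedUnder T.static T.initial)
    (hM : ∀ x, x ∈ M ↔ Derives (gologProgram T Δ P n) M x) : stateAt M 0 = T.initial := by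
  ext l
  constructor
  · intro hl
    refine Derives.support_induction (motive := fun x => ∀ l, x = .holds l 0 → l ∈ T.initial)
      ?_ ((hM _).1 hl) l rfl
    rintro x hx l rfl
    rcases hx with ⟨-, h⟩ | ⟨-, r, hr, rfl, h⟩ | ⟨k, -, hk, -⟩
    · exact h
    · exact hT r hr fun g hg => (h g hg).2 g rfl
    · omega
  · exact fun hl => (hM _).2 (.of_planningRule (.initially l hl) (by simp) (by simp))

theorem executable_of_possible (hM : ∀ x, x ∈ M ↔ Derives (gologProgram T Δ P n) M x)
    {a : GAction σ} {t : ℕ} (h : Derives (gologProgram T Δ P n) M (.possible a t)) :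
    T.Executable a (stateAt M t) := by
  obtain ⟨-, r, hr, ha, h⟩ := h.support
  exact ⟨r, hr, ha, fun l hl => (hM _).2 (h l hl)⟩

/-- A literal kept by inertia lies in both states. So every derivation of a literal at time `t + 1`
starts from a direct effect or from the intersection and continues by static laws, which keeps it
inside any competing closed set. -/
theorem stateAt_succ_isClosure (hT : ∀ l ∈ T.initial, l ∈ T.literals)
    (hM : IsAnswerSet (gologProgram T Δ P n) M) {a : GAction σ} {t : ℕ} (ht : t < n)
    (ha : .occ a t ∈ M) :
    T.IsClosure (T.directEffects a (stateAt M t) ∪ (stateAt M t ∩ stateAt M (t + 1)))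
      (stateAt M (t + 1)) := by
  have hM' := (isAnswerSet_iff.1 hM).1
  refine ⟨⟨stateAt_subset_literals hT hM' _, stateAt_consistent hT hM ht, ?_, ?_⟩, ?_⟩
  · rintro l (⟨r, hr, rfl, rfl, hp⟩ | ⟨-, hl⟩)
    · exact (hM' _).2 (.causes hr ht.le ((hM' _).1 ha) fun g hg => (hM' _).1 (hp g hg))
    · exact hl
  · exact fun r hr hp => (hM' _).2 (.caused hr ht fun g hg => (hM' _).1 (hp g hg))
  · rintro w ⟨-, -, hw, hcl⟩ l hl
    refine Derives.support_induction (motive := fun x => ∀ l, x = .holds l (t + 1) → l ∈ w)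
      ?_ ((hM' _).1 hl) l rfl
    rintro x hx l rfl
    have hx' := hx
    rcases hx with ⟨h, -⟩ | ⟨-, r, hr, rfl, h⟩ |
      ⟨k, hk, hkt, ⟨r, hr, rfl, ho, h⟩ | ⟨hlit, h, hK⟩⟩
    · omega
    · exact hcl r hr fun g hg => (h g hg).2 g rfl
    · obtain rfl : t = k := by omega
      exact hw (Or.inl ⟨r, hr, occ_unique hM' ha ((hM' _).2 ho.1), rfl,
        fun g hg => (hM' _).2 (h g hg).1⟩)
    · obtain rfl : t = k := by omega
      exact hw (Or.inr ⟨(hM' _).2 h.1,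
        (hM' _).2 (.inertia hk (Derives.support (Derives.support hlit.1)) h.1 hK)⟩)

/-- The states of an answer set form a trajectory. -/
theorem isTrajectory_stateAt (hT : T.IsState T.initial)
    (hM : IsAnswerSet (gologProgram T Δ P n) M) {a : ℕ → GAction σ}
    (ha : ∀ t < n, .occ (a t) t ∈ M) : T.IsTrajectory n (stateAt M) a := by
  have hM' := (isAnswerSet_iff.1 hM).1
  have hcl : ∀ t (ht : t < n), _ := fun t ht =>
    stateAt_succ_isClosure T.initial_wf hM ht (ha t ht)
  have hs : ∀ t ≤ n, T.IsState (stateAt M t) := by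
    intro t
    induction t with
    | zero => exact fun _ => (stateAt_zero hT.2 hM').symm ▸ hT
    | succ t ih =>
      intro ht
      refine (hcl t ht).isState_of_complete fun l hl hc => ?_
      have ih := ActionTheory.isInterpretation_iff.1 (ih (by omega)).1
      by_contra hn
      -- If both `l` and its contrary were missing at `t + 1`, inertia would be unblocked for
      -- whichever of them holds at `t`.
      refine hn ((hM' _).2 (.inertia (by omega) hl ((hM' _).1 (ih.2.2 l hl fun h => ?_)) hc))
      exact hc ((hM' _).2 (.inertia (by omega) (by simpa [ActionTheory.literals] using hl)
        ((hM' _).1 h) (by rwa [Lit.compl_compl])))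
  refine ⟨hs, fun t ht => ?_⟩
  have ho := ((hM' _).1 (ha t ht)).support
  exact ⟨ho.2.1.support, executable_of_possible hM' ho.2.2.1, hs _ ht, hcl t ht⟩

end AnswerSetToTrace

/-! ### From trajectories to answer sets -/

section TraceToAnswerSet

variable {σ : Signature.{u}} {π : ProcNames.{v}}

/-- The sets `S t` of literals and the relation `O`, telling which action occurs when, describe a
development of the theory over the time points `0, …, n`, where possibly a last action occurs at
time `n`. The static laws are not applied to its effects. -/
structure IsRun (T : ActionTheory σ) (n : ℕ) (S : ℕ → Set (Lit σ))
    (O : GAction σ → ℕ → Prop) : Prop where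
  initial : S 0 = T.initial
  isState : ∀ t ≤ n, T.IsState (S t)
  executable : ∀ a t, O a t → t ≤ n ∧ T.Executable a (S t)
  unique : ∀ a b t, O a t → O b t → a = b
  exists_occ : ∀ a, ∀ t ≤ n, T.Executable a (S t) → ∃ b, O b t
  isLeast : ∀ t ≤ n, IsLeast {w | (∀ a, O a t → T.directEffects a (S t) ⊆ w) ∧
    {l ∈ S t | l.compl ∉ S (t + 1)} ⊆ w ∧ (t < n → ClosedUnder T.static w)} (S (t + 1))

theorem ActionTheory.Executable.mem_actions {T : ActionTheory σ} {a : GAction σ} {s : Set (Lit σ)}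
    (h : T.Executable a s) : a ∈ T.actions := by
  obtain ⟨r, hr, rfl, -⟩ := h
  exact (T.exec_wf r hr).1

/-- The formulas that the rules of a program with facts `X` evaluate to true in `w`. -/
def EvalsTrue (T : ActionTheory σ) (X : Set (Atom σ π)) (w : Set (Lit σ)) : GFormula σ → Prop
  | .atom f => f ∈ T.fluents ∧ Lit.pos f ∈ w
  | .and φ ψ => .conj (.test (.and φ ψ)) (.test φ) (.test ψ) ∈ X ∧
      EvalsTrue T X w φ ∧ EvalsTrue T X w ψ
  | .or φ ψ => .disj (.test (.or φ ψ)) (.test φ) (.test ψ) ∈ X ∧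
      (EvalsTrue T X w φ ∨ EvalsTrue T X w ψ)
  | .neg φ => (∃ f ∈ T.fluents, φ = .atom f ∧ Lit.neg f ∈ w) ∨
      (.negation (.test (.neg φ)) (.test φ) ∈ X ∧ ¬ EvalsTrue T X w φ)

variable {T : ActionTheory σ} {Δ : Finset (Lit σ)} {P : Program σ π} {n : ℕ}
  {S : ℕ → Set (Lit σ)} {O : GAction σ → ℕ → Prop}

variable (T P n S O) in
/-- The intended extensions of the predicates defined by the program, except for `trans`; those
that do not occur negatively are described only as far as needed. -/
def Intended : Atom σ π → Prop
  | .action a => a ∈ T.actions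
  | .fluent f => f ∈ T.fluents
  | .literal l => l ∈ T.literals
  | .holds l t => l ∈ S t
  | .possible a t => T.Executable a (S t)
  | .occ a t => O a t
  | .nocc a t => t ≤ n ∧ a ∈ T.actions ∧ ∃ b, a ≠ b ∧ O b t
  | .hf N t => t ≤ n ∧ ∃ φ : GFormula σ, N = .test φ ∧ EvalsTrue T P.facts (S t) φ
  | _ => True

/-- Only intended atoms are derivable. -/
theorem IsRun.intended (hR : IsRun T n S O) {x : Atom σ π}
    (hx : Derives (gologProgram T Δ P n) {x | Intended T P n S O x} x) :
    Intended T P n S O x := by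
  refine Derives.support_induction ?_ hx
  intro x hx
  cases x with
  | action a => exact hx
  | fluent f => exact hx
  | literal l => exact hx.2
  | holds l t =>
    rcases hx with ⟨rfl, h⟩ | ⟨ht, r, hr, rfl, h⟩ |
      ⟨k, hk, rfl, ⟨r, hr, rfl, ho, h⟩ | ⟨hlit, h, hK⟩⟩
    · exact hR.initial.superset h
    · exact (hR.isState t ht).2 r hr fun g hg => (h g hg).2
    · exact (hR.isLeast k hk).1.1 _ ho.2 ⟨r, hr, rfl, rfl, fun g hg => (h g hg).2⟩
    · exact (hR.isLeast k hk).1.2.1 ⟨h.2, hK⟩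
  | possible a t =>
    obtain ⟨ht, r, hr, rfl, h⟩ := hx
    exact ⟨r, hr, rfl, fun g hg => (h g hg).2⟩
  | occ a t =>
    obtain ⟨ht, ha, hp, hK⟩ := hx
    -- Some action occurs whenever one is executable. If it is not `a`, then the intended `nocc`
    -- atom for `a` blocks the rule.
    obtain ⟨b, hb⟩ := hR.exists_occ a t ht hp.2
    by_cases hab : a = b
    · exact hab ▸ hb
    · exact (hK ⟨ht, ha.2, b, hab, hb⟩).elim
  | nocc a t =>
    obtain ⟨ht, ha, b, hab, hb⟩ := hx
    exact ⟨ht, ha.2, b, hab, hb.2⟩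
  | hf N t =>
    obtain ⟨ht, hx⟩ := hx
    refine ⟨ht, ?_⟩
    rcases hx with ⟨l, rfl, hl, h⟩ | ⟨_, _, hf, h₁, h₂⟩ | ⟨_, _, hf, h⟩ | ⟨_, hf, hK⟩
    · cases l with
      | pos f => exact ⟨_, rfl, hl.2, h.2⟩
      | neg f => exact ⟨_, rfl, Or.inl ⟨f, hl.2, rfl, h.2⟩⟩
    · obtain ⟨φ, ψ, rfl, rfl, rfl, -⟩ := P.factSpec hf
      obtain ⟨-, _, e₁, h₁⟩ := h₁.2
      obtain ⟨-, _, e₂, h₂⟩ := h₂.2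
      cases e₁
      cases e₂
      exact ⟨_, rfl, hf, h₁, h₂⟩
    · obtain ⟨φ, ψ, rfl, rfl, rfl, -⟩ := P.factSpec hf
      refine ⟨_, rfl, hf, ?_⟩
      rcases h with ⟨-, -, _, e, h⟩ | ⟨-, -, _, e, h⟩ <;> cases e
      exacts [Or.inl h, Or.inr h]
    · obtain ⟨φ, -, rfl, rfl, -⟩ := P.factSpec hf
      exact ⟨_, rfl, Or.inr ⟨hf, fun h => hK ⟨ht, _, rfl, h⟩⟩⟩
  | _ => trivial

theorem IsRun.literals_of_mem (hR : IsRun T n S O) {t : ℕ} (ht : t ≤ n) {l : Lit σ}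
    (hl : l ∈ S t) : l ∈ T.literals :=
  (hR.isState t ht).1.1.1 hl

theorem IsRun.derives_occ (hR : IsRun T n S O) {t : ℕ} (ht : t ≤ n)
    (hS : ∀ l ∈ S t,
      Derives (gologProgram T Δ P n) {x | Intended T P n S O x} (.holds l t))
    {a : GAction σ} (ha : O a t) :
    Derives (gologProgram T Δ P n) {x | Intended T P n S O x} (.occ a t) := by
  have hE := (hR.executable a t ha).2
  refine .occ ht hE.mem_actions ?_ ?_
  · obtain ⟨r, hr, rfl, h⟩ := hE
    exact .possible hr ht fun g hg => hS g (h g hg)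
  · rintro ⟨-, -, b, hab, hb⟩
    exact hab (hR.unique a b t ha hb)

/-- The literals derivable at `t + 1` have the closure properties of which `S (t + 1)` is the least
instance. The bound is `n + 1` because inertia at time `n` negates `holds` atoms of time `n + 1`. -/
theorem IsRun.derives_holds (hR : IsRun T n S O) {t : ℕ} (ht : t ≤ n + 1) {l : Lit σ}
    (hl : l ∈ S t) :
    Derives (gologProgram T Δ P n) {x | Intended T P n S O x} (.holds l t) := by
  induction t generalizing l with
  | zero => exact .of_planningRule (.initially l (hR.initial ▸ hl)) (by simp) (by simp)
  | succ t ih =>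
    have ht' : t ≤ n := by omega
    replace ih := fun l (hl : l ∈ S t) => ih (by omega) hl
    have hle := (hR.isLeast t ht').2
    refine @hle {l | Derives (gologProgram T Δ P n) {x | Intended T P n S O x}
      (.holds l (t + 1))} ⟨?_, ?_, ?_⟩ l hl
    · rintro a ha _ ⟨r, hr, rfl, rfl, hp⟩
      exact .causes hr ht' (hR.derives_occ ht' ih ha) fun g hg => ih g (hp g hg)
    · exact fun l hl => .inertia ht' (hR.literals_of_mem ht' hl.1) (ih l hl.1) hl.2
    · exact fun h r hr hp => .caused hr h hp

theorem IsRun.derives_hf (hR : IsRun T n S O) {t : ℕ} (ht : t ≤ n) {φ : GFormula σ}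
    (h : EvalsTrue T P.facts (S t) φ) :
    Derives (gologProgram T Δ P n) {x | Intended T P n S O x} (.hf (.test φ) t) := by
  induction φ with
  | atom f => exact .hf_litLabel (l := .pos f) h.1 ht (hR.derives_holds (by omega) h.2)
  | and φ ψ ih₁ ih₂ => exact .hf_conj h.1 ht (ih₁ h.2.1) (ih₂ h.2.2)
  | or φ ψ ih₁ ih₂ => exact .hf_disj h.1 ht (h.2.imp ih₁ ih₂)
  | neg φ ih =>
    rcases h with ⟨f, hf, rfl, h⟩ | ⟨hX, h⟩
    · exact .hf_litLabel (l := .neg f) hf ht (hR.derives_holds (by omega) h)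
    · refine .hf_negation hX ht ?_
      rintro ⟨-, _, e, h'⟩
      cases e
      exact h h'

/-- Intended atoms with times up to `n` that occur in negative bodies are derivable. -/
theorem IsRun.derives_of_neg (hR : IsRun T n S O) {h : Option (Atom σ π)} {p m : Set (Atom σ π)}
    (hr : ⟨h, p, m⟩ ∈ gologProgram T Δ P n) (hh : h ≠ none) {y : Atom σ π} (hy : y ∈ m)
    (hI : Intended T P n S O y) :
    Derives (gologProgram T Δ P n) {x | Intended T P n S O x} y := by
  have hhf : ∀ N t, Intended T P n S O (.hf N t) →
      Derives (gologProgram T Δ P n) {x | Intended T P n S O x} (.hf N t) := by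
    rintro N t ⟨ht, φ, rfl, h⟩
    exact hR.derives_hf ht h
  rcases hr with (((hr | hr) | hr) | ⟨y, hy, hr⟩) | hr
  · cases hr <;> try exact hy.elim
    · obtain rfl := hy
      obtain ⟨ht, ha, b, hab, hb⟩ := hI
      exact .nocc ht ha hab (hR.derives_occ ht (fun l hl => hR.derives_holds (by omega) hl) hb)
    · obtain rfl := hy
      exact hR.derives_holds (by omega) hI
  · cases hr <;> try exact hy.elim
    obtain rfl := hy
    exact hhf _ _ hI
  · cases hr <;> try exact hy.elim
    all_goals
      obtain rfl := hy
      exact hhf _ _ hI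
  · cases hr
    exact hy.elim
  · cases hr
    -- This is where heads `⊥` are excluded: the guess says nothing useful about the `trans` atom
    -- negated in the constraint.
    exact (hh rfl).elim

/-- A run gives rise to a fixed point with the same states and actions. -/
theorem IsRun.exists_fixedPoint (hR : IsRun T n S O) : ∃ M : Set (Atom σ π),
    (∀ x, x ∈ M ↔ Derives (gologProgram T Δ P n) M x) ∧ (∀ t ≤ n, stateAt M t = S t) ∧
      ∀ a t, O a t → .occ a t ∈ M := by
  refine ⟨{x | Derives (gologProgram T Δ P n) {x | Intended T P n S O x} x},
    fun x => ⟨fun hx => ?_, fun hx => ?_⟩, fun t ht => ?_, fun a t ha => ?_⟩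
  -- All atoms of the constructed set are intended, so a rule that the guess leaves unblocked is
  -- unblocked by that set as well.
  · exact Derives.congr (fun _ _ _ _ _ _ hy => hR.intended hy) hx
  -- Conversely, a negated atom that is intended is derivable, so whatever the guess blocks is
  -- blocked by the constructed set.
  · exact Derives.congr (fun _ _ _ hr _ hy hI => hR.derives_of_neg hr (by simp) hy hI) hx
  · exact Set.ext fun l => ⟨fun h => hR.intended h, fun h => hR.derives_holds (by omega) h⟩
  · have ht := (hR.executable a t ha).1
    exact hR.derives_occ ht (fun l hl => hR.derives_holds (by omega) hl) ha

/-- A trajectory extends to a run. -/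
theorem exists_isRun {s : ℕ → Set (Lit σ)} {a : ℕ → GAction σ} (h : T.IsTrajectory n s a)
    (h0 : s 0 = T.initial) : ∃ S O, IsRun T n S O ∧ (∀ t ≤ n, S t = s t) ∧ ∀ t < n, O (a t) t := by
  -- `B` holds the action at time `n`, on which the trajectory is silent: one executable action if
  -- there is any, otherwise none.
  obtain ⟨B, hB₁, hB₂, hB₃⟩ : ∃ B : Set (GAction σ), (∀ b ∈ B, T.Executable b (s n)) ∧
      (∀ b ∈ B, ∀ c ∈ B, b = c) ∧ ∀ b, T.Executable b (s n) → B.Nonempty := by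
    by_cases hb : ∃ b, T.Executable b (s n)
    · obtain ⟨b, hb⟩ := hb
      exact ⟨{b}, by simpa using hb, by simp, by simp⟩
    · exact ⟨∅, by simp, by simp, fun b h => (hb ⟨b, h⟩).elim⟩
  let E : Set (Lit σ) := ⋃ b ∈ B, T.directEffects b (s n)
  have hcons : ∀ t ≤ n, ∀ l ∈ s t, l.compl ∉ s t := fun t ht l hl =>
    (h.1 t ht).1.1.2.compl_notMem hl
  -- At time `n + 1` stand the effects of the last action and the old literals they do not
  -- contradict. This set may be inconsistent or violate static laws, since neither is tested beyond
  -- time `n`.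
  refine ⟨fun t => if t ≤ n then s t else E ∪ {l ∈ s n | l.compl ∉ E},
    fun b t => (t < n ∧ b = a t) ∨ (t = n ∧ b ∈ B), ⟨?_, ?_, ?_, ?_, ?_, ?_⟩, ?_, ?_⟩
  · simpa using h0
  · intro t ht
    simpa [ht] using h.1 t ht
  · rintro b t (⟨ht, rfl⟩ | ⟨rfl, hb⟩)
    · simpa [ht.le] using (h.2 t ht).2.1
    · simpa using hB₁ b hb
  · rintro b c t (⟨ht, rfl⟩ | ⟨rfl, hb⟩) (⟨ht', rfl⟩ | ⟨ht', hc⟩)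
    · rfl
    · omega
    · omega
    · exact hB₂ b hb c hc
  · intro b t ht hb
    rcases ht.lt_or_eq with ht | rfl
    · exact ⟨_, Or.inl ⟨ht, rfl⟩⟩
    · obtain ⟨c, hc⟩ := hB₃ b (by simpa using hb)
      exact ⟨c, Or.inr ⟨rfl, hc⟩⟩
  · intro t ht
    rcases ht.lt_or_eq with ht | rfl
    · have hs : (if t ≤ n then s t else E ∪ {l ∈ s n | l.compl ∉ E}) = s t := if_pos ht.le
      have hs' : (if t + 1 ≤ n then s (t + 1) else E ∪ {l ∈ s n | l.compl ∉ E}) = s (t + 1) :=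
        if_pos ht
      simp only [hs, hs']
      obtain ⟨-, -, hst, hcl⟩ := h.2 t ht
      have hmax := (ActionTheory.isInterpretation_iff.1 hst.1).2.2
      refine ⟨⟨?_, ?_, fun _ => hst.2⟩, ?_⟩
      · rintro b (⟨-, rfl⟩ | ⟨ht', -⟩)
        · exact fun l hl => hcl.1.2.2.1 (Or.inl hl)
        · omega
      · exact fun l hl => hmax l ((h.1 t ht.le).1.1.1 hl.1) hl.2
      · rintro w ⟨hw₁, hw₂, hw₃⟩
        have hle := hcl.2
        -- `w` need not be consistent, but the closure is least only among consistent sets of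
        -- literals; intersecting with the next state repairs this.
        refine Set.Subset.trans (@hle (w ∩ s (t + 1)) ⟨?_, ?_, ?_, ?_⟩) Set.inter_subset_left
        · exact Set.inter_subset_right.trans hst.1.1.1
        · exact fun f hf => hst.1.1.2 f ⟨hf.1.2, hf.2.2⟩
        · rintro l (hl | hl)
          · exact ⟨hw₁ (a t) (Or.inl ⟨ht, rfl⟩) hl, hcl.1.2.2.1 (Or.inl hl)⟩
          · exact ⟨hw₂ ⟨hl.1, hcons _ ht l hl.2⟩, hl.2⟩
        · exact fun r hr hp => ⟨hw₃ ht r hr fun l hl => (hp l hl).1, hst.2 r hr fun l hl =>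
            (hp l hl).2⟩
    · have hs : (if t ≤ t then s t else E ∪ {l ∈ s t | l.compl ∉ E}) = s t := if_pos le_rfl
      have hs' : (if t + 1 ≤ t then s (t + 1) else E ∪ {l ∈ s t | l.compl ∉ E}) =
        E ∪ {l ∈ s t | l.compl ∉ E} := if_neg (by omega)
      rw [hs, hs']
      refine ⟨⟨?_, ?_, fun h => (lt_irrefl _ h).elim⟩, ?_⟩
      · rintro b (⟨ht', -⟩ | ⟨-, hb⟩)
        · omega
        · exact fun l hl => Or.inl (Set.mem_biUnion hb hl)
      · exact fun l hl => Or.inr ⟨hl.1, fun h => hl.2 (Or.inl h)⟩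
      · rintro w ⟨hw₁, hw₂, -⟩ l (hl | hl)
        · obtain ⟨b, hb, hl⟩ := Set.mem_iUnion₂.1 hl
          exact hw₁ b (Or.inr ⟨rfl, hb⟩) hl
        -- Since `s t` is consistent, the contrary of one of its literals could be present at the
        -- next time only as an effect in `E`.
        · refine hw₂ ⟨hl.1, ?_⟩
          rintro (h' | h')
          · exact hl.2 h'
          · exact hcons _ le_rfl l hl.1 h'.1
  · exact fun t ht => if_pos ht
  · exact fun t ht => Or.inl ⟨ht, rfl⟩

end TraceToAnswerSet

/-- Satisfaction of formulas and unfolding depend on the states up to the final time only. -/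
theorem TraceOf.congr {σ : Signature.{u}} {π : ProcNames.{v}} {S : Procedures σ π}
    {s s' : ℕ → Set (Lit σ)} {a : ℕ → GAction σ} {n : ℕ} (hs : ∀ t ≤ n, s t = s' t)
    {δ : GCAction σ π} {i j : ℕ} (h : TraceOf S s a δ i j) (hj : j ≤ n) :
    TraceOf S s' a δ i j ∧ i ≤ j := by
  induction h with
  | act i => exact ⟨.act i, by omega⟩
  | test i h => exact ⟨.test i (hs i hj ▸ h), le_rfl⟩
  | seq h₁ h₂ _ _ ih₁ ih₂ =>
    exact ⟨.seq h₁ h₂ (ih₁ (h₂.trans hj)).1 (ih₂ hj).1, h₁.trans h₂⟩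
  | choice l _ ih => exact ⟨.choice l (ih hj).1, (ih hj).2⟩
  | ite_true h _ ih =>
    have ih := ih hj
    exact ⟨.ite_true (hs _ (ih.2.trans hj) ▸ h) ih.1, ih.2⟩
  | ite_false h _ ih =>
    have ih := ih hj
    exact ⟨.ite_false (hs _ (ih.2.trans hj) ▸ h) ih.1, ih.2⟩
  | loop_false i h => exact ⟨.loop_false i (hs i hj ▸ h), le_rfl⟩
  | loop_true h h₁ h₂ _ _ ih₁ ih₂ =>
    exact ⟨.loop_true (hs _ (h₁.le.trans (h₂.trans hj)) ▸ h) h₁ h₂ (ih₁ (h₂.trans hj)).1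
      (ih₂ hj).1, h₁.le.trans h₂⟩
  | pick y hy _ ih => exact ⟨.pick y hy (ih hj).1, (ih hj).2⟩
  | call _ ih => exact ⟨.call (ih hj).1, (ih hj).2⟩
  | null i => exact ⟨.null i, le_rfl⟩

end GologPlanning

theorem mainTheorem6 {σ : Signature} {π : ProcNames} (T : ActionTheory σ)
    (hT : T.IsConsistent) (Δ : Finset (Lit σ)) (P : Program σ π) (hP : P.IsOver T) (n : ℕ) :
    (∀ (M : Set (Atom σ π)) (a : ℕ → GAction σ),
        IsAnswerSet (gologProgram T Δ P n) M →
        (∀ i < n, Atom.occ (a i) i ∈ M) →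
        IsTrace T P n (stateAt M) a) ∧
    (∀ (s : ℕ → Set (Lit σ)) (a : ℕ → GAction σ),
        IsTrace T P n s a → s 0 = T.initial →
        ∃ M : Set (Atom σ π), IsAnswerSet (gologProgram T Δ P n) M ∧
          (∀ j ≤ n, s j = stateAt M j) ∧ ∀ i < n, Atom.occ (a i) i ∈ M) := by
  constructor
  · intro M a hM ha
    have htraj := isTrajectory_stateAt hT.2 hM ha
    obtain ⟨hfix, hcon⟩ := isAnswerSet_iff.1 hM
    refine ⟨htraj, ?_⟩
    have hgoal : Atom.trans (label P.procs P.body) 0 n ∈ M := by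
      by_contra h
      exact hcon ∅ {Atom.trans (label P.procs P.body) 0 n} (Or.inr (Set.mem_singleton _)) (Set.empty_subset _)
        (Set.disjoint_singleton_left.2 h)
    have ho : OverFluents T P.procs P.body := hP
    have := traceOf_of_trans hfix (fun t ht => (htraj.1 t ht).1)
      (fun t ht b hb => occ_unique hfix (ha t ht) hb) hgoal le_rfl (ho.core_label_of P.coherent)
    rw [core_label P.coherent] at this
    exact this.of_core
  · rintro s a ⟨htraj, htrace⟩ h0
    obtain ⟨S, O, hR, hS, hO⟩ := exists_isRun htraj h0
    obtain ⟨M, hM, hMS, hMO⟩ := hR.exists_fixedPoint (Δ := Δ) (P := P)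
    have hs : ∀ t ≤ n, s t = stateAt M t := fun t ht => by rw [hMS t ht, hS t ht]
    have hst : ∀ t ≤ n, T.IsState (stateAt M t) := fun t ht => hs t ht ▸ htraj.1 t ht
    have ha : ∀ t < n, .occ (a t) t ∈ M := fun t ht => hMO _ _ (hO t ht)
    refine ⟨M, isAnswerSet_iff.2 ⟨hM, ?_⟩, hs, ha⟩
    rintro p m ((((hr | hr) | hr) | ⟨y, hy, hr⟩) | hr) hp hm
    -- Consistency is the only constraint among the planning rules, and its times stop at `n`, where
    -- the states are those of the trajectory.
    · cases hr with
      | consistency f t ht => exact (hst t ht).1.1.2 f ⟨hp (by simp), hp (by simp)⟩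
    · cases hr
    · cases hr
    · cases hr
    · cases hr
      refine Set.disjoint_singleton_left.1 hm ?_
      -- The given states and those of `M` are known to agree only up to time `n`, so the trace is
      -- first transferred to the latter.
      exact trans_of_traceOf hM (fun t ht => (hst t ht).1) ha (htrace.congr hs le_rfl).1 le_rfl hP
        (nameFor_label _ _) P.encode_body_subset_facts
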